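/- Let $(X,d)$ be a metric space, $f\colon X\to[-\infty,+\infty]$ lower semicontinuous, $K\in\mathbb R$ and $N<0$. Put $\mathcal D[f]=\{f\neq\pm\infty\}$, $\mathcal D^\star[f]=\{f<+\infty\}$ and $f_N=e^{-f/N}\in[0,+\infty]$. For $\theta\ge 0$ let $\mathfrak s_{K,N}(\theta)$ be $\frac{\sin(\theta\sqrt{K/N})}{\sqrt{K/N}}$ if $K<0$, $\theta$ if $K=0$, and $\frac{\sinh(\theta\sqrt{-K/N})}{\sqrt{-K/N}}$ if $K>0$. Let $\sigma^{(t)}_{K,N}(\theta)=t$ if $K\theta^2=0$, $\sigma^{(t)}_{K,N}(\theta)=\mathfrak s_{K,N}(t\theta)/\mathfrak s_{K,N}(\theta)$ if $K\theta^2\ne 0$ and $K\theta^2>N\pi^2$, and $\sigma^{(t)}_{K,N}(\theta)=+\infty$ otherwise; $0\cdot\infty=0$. The function $f$ is *$(K,N)$-convex* if for all $x_0,x_1\in\mathcal D^\star[f]$ (with $d(x_0,x_1)<\pi\sqrt{N/K}$ when $K<0$) there is a constant-speed minimizing geodesic $\gamma\colon[0,1]\to X$ from $x_0$ to $x_1$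 with $f_N(\gamma_t)\le\sigma^{(1-t)}_{K,N}(d(x_0,x_1))f_N(x_0)+\sigma^{(t)}_{K,N}(d(x_0,x_1))f_N(x_1)$ for all $t\in[0,1]$. A curve $(y_t)_{t\in(0,T)}$, $T\in(0,+\infty]$, *starts at* $x\in X$ if $\lim_{t\downarrow0}y_t=x$. An *$\mathrm{EVI}_{K,N}$ gradient curve* for $f$ is a continuous curve $(y_t)_{t\in(0,T)}\subset\mathcal D[f]$ such that $$\frac{d^+}{dt}\Big[\mathfrak s_{K,N}\Big(\tfrac{d(y_t,z)}2\Big)^2\Big]+K\,\mathfrak s_{K,N}\Big(\tfrac{d(y_t,z)}2\Big)^2\le\frac N2\Big(1-\frac{f_N(z)}{f_N(y_t)}\Big)$$ for every $t\in(0,T)$ and $z\in\mathcal D^\star[f]$ (with $d(y_t,z)<\pi\sqrt{N/K}$ when $K<0$), where $\frac{d^+}{dt}u(t)=\limsup_{h\downarrow0}\frac{u(t+h)-u(t)}h$. A *curve of maximal slope* for $f$ is a curve $(y_t)_{t\in(0,T)}\subset\mathcal D[f]$ such that $t\mapsto y_t$ and $t\mapsto f(y_t)$ are locally absolutely continuous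 on $(0,T)$ and $-\frac{d}{dt}f(y_t)\ge\frac12|\dot y_t|^2+\frac12|D^-f|^2(y_t)$ for a.e. $t\in(0,T)$, where $|\dot y_t|$ is the metric speed and $|D^-f|(x)=\limsup_{z\to x}\frac{(f(z)-f(x))^-}{d(z,x)}$. **Theorem.** Let $T\in(0,+\infty]$, let $(y_t)_{t\in(0,T)}$ be a curve of maximal slope for $f$ starting at $y_0\in X$, and let $(y'_t)_{t\in(0,T)}$ be an $\mathrm{EVI}_{K,N}$ gradient curve for $f$ starting at the same point $y_0$. Assume that $\mathrm{EVI}_{K,N}$ gradient curves exist in a set $D\subset\mathcal D[f]$ which contains the image of $(y_t)_{t\in(0,T)}$, in the sense that every $x\in D$ is the starting point of some $\mathrm{EVI}_{K,N}$ gradient curve for $f$, defined on some interval $(0,\tau)$ with $\tau\in(0,+\infty]$. If either $K\ge 0$, or $f$ is $(K,N)$-convex and bounded above, then $y_t=y'_t$ for every $t\in(0,T)$. -/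

import Mathlib

open Filter Topology Set
open scoped ENNReal

namespace MetricFlow

noncomputable section

/-! ### Functionals with values in `[-∞, +∞]` -/

/-- The finiteness domain `D[f] = {x | f x ≠ ±∞}`. -/
def finDomain {X : Type*} (f : X → EReal) : Set X := {x | f x ≠ ⊥ ∧ f x ≠ ⊤}

/-- The extended domain `D⋆[f] = {x | f x < +∞}`. -/
def extDomain {X : Type*} (f : X → EReal) : Set X := {x | f x < ⊤}

/-- `f_N = exp (-f / N)`, with values in `[0, +∞]`; for `N < 0` it is `0` where `f = -∞` and `+∞`
where `f = +∞`. -/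
def expTransform {X : Type*} (N : ℝ) (f : X → EReal) (x : X) : ℝ≥0∞ :=
  EReal.exp (-(f x) / (N : EReal))

/-! ### `(K, N)`-convexity for negative `N` -/

/-- The generalized sine `𝔰_{K,N}` (for `N < 0`). -/
def genSin (K N θ : ℝ) : ℝ :=
  if K < 0 then Real.sin (θ * √(K / N)) / √(K / N)
  else if K = 0 then θ
  else Real.sinh (θ * √(-K / N)) / √(-K / N)

/-- The distortion coefficient `σ_{K,N}^{(t)}(θ)` (for `N < 0`). -/
def distortion (K N t θ : ℝ) : ℝ≥0∞ :=
  if K * θ ^ 2 = 0 then ENNReal.ofReal t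
  else if N * Real.pi ^ 2 < K * θ ^ 2 then ENNReal.ofReal (genSin K N (t * θ) / genSin K N θ)
  else ⊤

/-- `γ`, restricted to `[0,1]`, is a constant-speed minimizing geodesic from `x₀` to `x₁`. -/
def IsGeodesic {X : Type*} [MetricSpace X] (γ : ℝ → X) (x₀ x₁ : X) : Prop :=
  γ 0 = x₀ ∧ γ 1 = x₁ ∧
    ∀ s ∈ Icc (0 : ℝ) 1, ∀ t ∈ Icc (0 : ℝ) 1, dist (γ s) (γ t) = |t - s| * dist x₀ x₁

/-- `f` is `(K, N)`-convex (for `N < 0`). -/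
def IsKNConvex {X : Type*} [MetricSpace X] (K N : ℝ) (f : X → EReal) : Prop :=
  ∀ x₀ ∈ extDomain f, ∀ x₁ ∈ extDomain f, (K < 0 → dist x₀ x₁ < Real.pi * √(N / K)) →
    ∃ γ : ℝ → X, IsGeodesic γ x₀ x₁ ∧ ∀ t ∈ Icc (0 : ℝ) 1,
      expTransform N f (γ t) ≤
        distortion K N (1 - t) (dist x₀ x₁) * expTransform N f x₀ +
          distortion K N t (dist x₀ x₁) * expTransform N f x₁

/-! ### Curves on `(0, T)` with `T ∈ (0, +∞]` -/

/-- The interval `(0, T)`; `T = ⊤` gives `(0, +∞)`. -/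
def timeInterval (T : EReal) : Set ℝ := {t | 0 < t ∧ (t : EReal) < T}

/-- The curve starts at `x`, i.e. `y_t → x` as `t ↓ 0`. -/
def StartsAt {X : Type*} [TopologicalSpace X] (y : ℝ → X) (x : X) : Prop :=
  Tendsto y (𝓝[>] 0) (𝓝 x)

/-- The upper right Dini derivative `limsup_{h ↓ 0} (u (t + h) - u t) / h`. -/
def upperRightDeriv (u : ℝ → ℝ) (t : ℝ) : EReal :=
  limsup (fun h : ℝ => (((u (t + h) - u t) / h : ℝ) : EReal)) (𝓝[>] 0)

/-- `y`, restricted to `(0, T)`, is an `EVI_{K,N}` gradient curve for `f` (for `N < 0`). The two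
values of `f_N` are finite, and `f_N (y t)` is positive, so that `toReal` loses nothing. -/
structure IsEVICurve {X : Type*} [MetricSpace X] (K N : ℝ) (f : X → EReal) (T : EReal)
    (y : ℝ → X) : Prop where
  continuousOn : ContinuousOn y (timeInterval T)
  mem_finDomain : ∀ t ∈ timeInterval T, y t ∈ finDomain f
  evi : ∀ t ∈ timeInterval T, ∀ z ∈ extDomain f,
    (K < 0 → dist (y t) z < Real.pi * √(N / K)) →
      upperRightDeriv (fun r => genSin K N (dist (y r) z / 2) ^ 2) t
          + ((K * genSin K N (dist (y t) z / 2) ^ 2 : ℝ) : EReal) ≤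
        ((N / 2 * (1 - (expTransform N f z).toReal / (expTransform N f (y t)).toReal) : ℝ) : EReal)

/-- Local absolute continuity on `(0, T)`: absolute continuity on every compact subinterval. -/
def LocallyAC {X : Type*} [PseudoMetricSpace X] (T : EReal) (y : ℝ → X) : Prop :=
  ∀ a ∈ timeInterval T, ∀ b ∈ timeInterval T, AbsolutelyContinuousOnInterval y a b

/-- The metric speed `|ẏ_t|`, written as a limsup so that it is defined at every `t`; along a
locally absolutely continuous curve it is a limit at almost every `t`. -/
def metricSpeed {X : Type*} [MetricSpace X] (y : ℝ → X) (t : ℝ) : ℝ≥0∞ :=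
  limsup (fun h : ℝ => edist (y (t + h)) (y t) / ENNReal.ofReal |h|) (𝓝[≠] 0)

/-- The descending slope `|D⁻f|(x) = limsup_{z → x} (f z - f x)⁻ / d(z, x)` at a point of `D[f]`
(it is `0` at an isolated point). -/
def descendingSlope {X : Type*} [MetricSpace X] (f : X → EReal) (x : X) : ℝ≥0∞ :=
  limsup (fun z => (f x - f z).toENNReal / edist z x) (𝓝[≠] x)

/-- `y`, restricted to `(0, T)`, is a curve of maximal slope for `f`. -/
structure IsMaximalSlopeCurve {X : Type*} [MetricSpace X] (f : X → EReal) (T : EReal)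
    (y : ℝ → X) : Prop where
  mem_finDomain : ∀ t ∈ timeInterval T, y t ∈ finDomain f
  locallyAC : LocallyAC T y
  locallyAC_comp : LocallyAC T (fun t => (f (y t)).toReal)
  energy_dissipation : ∀ᵐ t : ℝ, t ∈ timeInterval T →
    ((metricSpeed y t ^ 2 / 2 + descendingSlope f (y t) ^ 2 / 2 : ℝ≥0∞) : EReal) ≤
      ((-deriv (fun r => (f (y r)).toReal) t : ℝ) : EReal)

end

end MetricFlow

namespace MetricFlow

/-! ### The function `d ↦ 𝔰_{K,N}(d / 2)²` -/

/-! The curve of maximal slope `y` is shown to satisfy the evolution variational inequality (EVI)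
itself at almost every time, and is then compared with `y'` after a change of time.

Tangency. Fix a good time `t`, put `x = y t`, and let `w` be an EVI curve starting at `x`. Its
initial speed is at most the descending slope `L` (`IsEVICurve.eventually_dist_le`), so `f (w r) ≥ f
x - L² r` up to `o(r)`. Integrating its EVI over `(0, h)` with test point `y (t + h)` bounds `d(w h,
y (t + h))² / 4` by `(m²/4 + L²/4 - P/2) h² + o(h²)`, where `m` is the speed of `y` and `P` its rate
of dissipation. Energy dissipation says precisely that the bracket is nonpositive, so the two curves
differ by `o(h)` (`IsEVICurve.eventually_dist_le_mul`) and `y` inherits the EVI at `t`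
(`IsMaximalSlopeCurve.ae_rightSlopeLE`).

Comparison. With `a = f (y' t)` and `b = f (y s)`, the two EVI right-hand sides `N/2 (1 - exp ((a -
b)/N))` and `N/2 (1 - exp ((b - a)/N))` do not cancel when added. They do once the second is
weighted by `κ = exp ((a - b)/N)` (`eviBound_add_mul_eviBound`). So `y` is run at speed `κ`, through
the time change `θ` which equates the primitives of `exp (f/N)` along the two curves
(`exists_time_change`). The comparison function `u` of the distance between `y (θ t)` and `y' t`
then has upper right derivative at most `-K (1 + κ) u`, and Gronwall gives `y ∘ θ = y'`. The values
of `f` now agree, so `θ' = 1` and `θ` is the identity. For `K < 0`, Gronwall needs `κ` bounded,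
which follows from the upper bound on `f`. This is local uniqueness after any common point
(`exists_eqOn_Ioo`); continuity propagates it to all of `(0, T)`. -/

/-- The comparison function `d ↦ 𝔰_{K,N}(d / 2)²` of the evolution variational inequality. -/
noncomputable def halfSinSq (K N d : ℝ) : ℝ := genSin K N (d / 2) ^ 2

lemma hasDerivAt_genSin_zero {K N : ℝ} (hN : N < 0) : HasDerivAt (genSin K N) 1 0 := by
  unfold genSin
  rcases lt_trichotomy K 0 with hK | rfl | hK
  · simp only [hK, if_true]
    have hs : 0 < √(K / N) := Real.sqrt_pos.2 (div_pos_of_neg_of_neg hK hN)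
    have h := (((hasDerivAt_id (0 : ℝ)).mul_const √(K / N)).sin).div_const √(K / N)
    refine h.congr_deriv ?_
    simp [hs.ne']
  · simpa using hasDerivAt_id' (0 : ℝ)
  · simp only [not_lt.2 hK.le, hK.ne', if_false]
    have hs : 0 < √(-K / N) := Real.sqrt_pos.2 (div_pos_of_neg_of_neg (by linarith) hN)
    have h := (((hasDerivAt_id (0 : ℝ)).mul_const √(-K / N)).sinh).div_const √(-K / N)
    refine h.congr_deriv ?_
    simp [hs.ne']

lemma contDiff_genSin (K N : ℝ) : ContDiff ℝ 1 (genSin K N) := by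
  unfold genSin
  split_ifs <;> fun_prop

lemma contDiff_halfSinSq (K N : ℝ) : ContDiff ℝ 1 (halfSinSq K N) :=
  ((contDiff_genSin K N).comp (contDiff_id.div_const 2)).pow 2

lemma continuous_halfSinSq (K N : ℝ) : Continuous (halfSinSq K N) :=
  (contDiff_halfSinSq K N).continuous

lemma genSin_zero (K N : ℝ) : genSin K N 0 = 0 := by
  simp [genSin]

@[simp] lemma halfSinSq_zero (K N : ℝ) : halfSinSq K N 0 = 0 := by
  simp [halfSinSq, genSin_zero]

lemma halfSinSq_nonneg (K N d : ℝ) : 0 ≤ halfSinSq K N d := sq_nonneg _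

/-- For `K < 0` the distance restriction keeps the argument of the sine below its first positive
zero. -/
lemma eq_zero_of_halfSinSq_eq_zero {K N d : ℝ} (hN : N < 0) (hd : 0 ≤ d)
    (hK : K < 0 → d < Real.pi * √(N / K)) (h : halfSinSq K N d = 0) : d = 0 := by
  have h0 : genSin K N (d / 2) = 0 := by simpa [halfSinSq] using h
  by_contra hne
  have hd' : 0 < d := lt_of_le_of_ne hd (Ne.symm hne)
  unfold genSin at h0
  rcases lt_trichotomy K 0 with hK0 | rfl | hK0
  · simp only [hK0, if_true] at h0
    have hs : 0 < √(K / N) := Real.sqrt_pos.2 (div_pos_of_neg_of_neg hK0 hN)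
    have hsin : 0 < Real.sin (d / 2 * √(K / N)) := by
      apply Real.sin_pos_of_pos_of_lt_pi (by positivity)
      have h1 : √(N / K) * √(K / N) = 1 := by
        rw [← Real.sqrt_mul (div_pos_of_neg_of_neg hN hK0).le,
          div_mul_div_cancel₀ hK0.ne, div_self hN.ne, Real.sqrt_one]
      have h2 : d * √(K / N) < Real.pi := by
        calc d * √(K / N) < Real.pi * √(N / K) * √(K / N) := by gcongr; exact hK hK0
          _ = Real.pi := by rw [mul_assoc, h1, mul_one]
      nlinarith [Real.pi_pos]
    exact (div_pos hsin hs).ne' h0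
  · simp only [lt_irrefl, if_false, if_true] at h0
    linarith
  · simp only [not_lt.2 hK0.le, hK0.ne', if_false] at h0
    have hs : 0 < √(-K / N) := Real.sqrt_pos.2 (div_pos_of_neg_of_neg (by linarith) hN)
    exact (div_pos (Real.sinh_pos_iff.2 (by positivity)) hs).ne' h0

lemma eventually_abs_halfSinSq_sub_le {K N ε : ℝ} (hN : N < 0) (hε : 0 < ε) :
    ∀ᶠ d in 𝓝 (0 : ℝ), |halfSinSq K N d - d ^ 2 / 4| ≤ ε * d ^ 2 := by
  have hlim : Tendsto (fun d : ℝ => d / 2) (𝓝 0) (𝓝 0) := by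
    have : Continuous fun d : ℝ => d / 2 := by fun_prop
    simpa using this.tendsto 0
  -- The error factors as a difference of squares; the cap at `1` keeps the factor with the plus
  -- sign below `2 |d|`.
  set η := min ε 1 with hη
  have hη0 : 0 < η := lt_min hε one_pos
  have h := (hasDerivAt_genSin_zero (K := K) hN).isLittleO.def hη0
  filter_upwards [hlim.eventually h] with d hd
  simp only [genSin_zero, sub_zero, smul_eq_mul, mul_one, Real.norm_eq_abs] at hd
  have h1 : |genSin K N (d / 2) + d / 2| ≤ 2 * |d| := by
    have : genSin K N (d / 2) + d / 2 = (genSin K N (d / 2) - d / 2) + d := by ring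
    rw [this]
    refine (abs_add_le _ _).trans ?_
    have h2 : η * |d / 2| ≤ 1 * |d| := by
      rw [abs_div]
      gcongr
      · exact min_le_right _ _
      · rw [abs_two]; linarith [abs_nonneg d]
    linarith
  have h3 : halfSinSq K N d - d ^ 2 / 4
      = (genSin K N (d / 2) - d / 2) * (genSin K N (d / 2) + d / 2) := by
    unfold halfSinSq; ring
  rw [h3, abs_mul]
  calc _ ≤ (η * |d / 2|) * (2 * |d|) := by gcongr
    _ = η * d ^ 2 := by rw [abs_div, abs_two, ← sq_abs d]; ring
    _ ≤ ε * d ^ 2 := by gcongr; exact min_le_left _ _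

/-! ### Comparison by upper right slopes -/

/-- The upper right Dini derivative of `u` at `t` is at most `c`. -/
def RightSlopeLE (u : ℝ → ℝ) (t c : ℝ) : Prop :=
  ∀ r, c < r → ∀ᶠ s in 𝓝[>] t, slope u t s < r

lemma RightSlopeLE.mono {u : ℝ → ℝ} {t c c' : ℝ} (h : RightSlopeLE u t c) (hc : c ≤ c') :
    RightSlopeLE u t c' := fun r hr => h r (hc.trans_lt hr)

lemma slope_lt_iff {u : ℝ → ℝ} {t s r : ℝ} (h : t < s) :
    slope u t s < r ↔ u s - u t < r * (s - t) := by
  rw [slope_def_field, div_lt_iff₀ (sub_pos.2 h)]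

/-- A differential inequality for the upper right derivative on an open interval can be
integrated, if the function has a limit at the left endpoint. -/
lemma sub_le_of_rightSlopeLE {u B B' : ℝ → ℝ} {a b u₀ : ℝ} (hab : a < b)
    (hu : ContinuousOn u (Ioc a b)) (hu₀ : Tendsto u (𝓝[>] a) (𝓝 u₀))
    (hB : ∀ t, HasDerivAt B (B' t) t)
    (hslope : ∀ t ∈ Ioo a b, RightSlopeLE u t (B' t)) : u b - u₀ ≤ B b - B a := by
  have hBc : Continuous B := continuous_iff_continuousAt.2 fun t => (hB t).continuousAt
  -- Nothing is known about the value of `u` at `a`, so the comparison starts at `a' > a` and `a'`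
  -- is then sent to `a`.
  have key : ∀ a' ∈ Ioo a b, u b ≤ B b + (u a' - B a') := by
    intro a' ha'
    refine image_le_of_liminf_slope_right_le_deriv_boundary (f := u) (a := a') (b := b)
      (B := fun t => B t + (u a' - B a')) (B' := B')
      (hu.mono fun t ht => ⟨ha'.1.trans_le ht.1, ht.2⟩) (by simp)
      (by fun_prop) (fun t _ => ((hB t).add_const _).hasDerivWithinAt)
      (fun t ht r hr => ((hslope t ⟨ha'.1.trans_le ht.1, ht.2⟩) r hr).frequently)
      (right_mem_Icc.2 ha'.2.le)
  have hl : Tendsto (fun a' => B b + (u a' - B a')) (𝓝[>] a) (𝓝 (B b + (u₀ - B a))) :=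
    tendsto_const_nhds.add (hu₀.sub (hBc.continuousAt.tendsto.mono_left nhdsWithin_le_nhds))
  have := ge_of_tendsto hl (by filter_upwards [Ioo_mem_nhdsGT hab] with t ht using key t ht)
  linarith

/-- Uniqueness in Gronwall's form: a nonnegative function vanishing at the left endpoint. -/
lemma nonpos_of_rightSlopeLE {u : ℝ → ℝ} {a b C : ℝ}
    (hu : ContinuousOn u (Ioc a b)) (hu₀ : Tendsto u (𝓝[>] a) (𝓝 0))
    (hslope : ∀ t ∈ Ioo a b, RightSlopeLE u t (C * u t)) : ∀ t ∈ Ioc a b, u t ≤ 0 := by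
  intro t ht
  have key : ∀ a' ∈ Ioo a t, u t ≤ u a' * Real.exp (C * (t - a')) := by
    intro a' ha'
    have h := le_gronwallBound_of_liminf_deriv_right_le (f := u) (f' := fun s => C * u s)
      (δ := u a') (K := C) (ε := 0) (a := a') (b := t)
      (hu.mono fun s hs => ⟨ha'.1.trans_le hs.1, hs.2.trans ht.2⟩)
      (fun s hs r hr => ((hslope s ⟨ha'.1.trans_le hs.1, hs.2.trans_le ht.2⟩) r hr).frequently)
      le_rfl (fun s _ => by simp) t (right_mem_Icc.2 ha'.2.le)
    rwa [gronwallBound_ε0] at h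
  have hl : Tendsto (fun a' => u a' * Real.exp (C * (t - a'))) (𝓝[>] a)
      (𝓝 (0 * Real.exp (C * (t - a)))) := by
    refine hu₀.mul ?_
    have : Continuous fun a' => Real.exp (C * (t - a')) := by fun_prop
    exact this.continuousAt.tendsto.mono_left nhdsWithin_le_nhds
  have := ge_of_tendsto hl (by filter_upwards [Ioo_mem_nhdsGT ht.1] with s hs using key s hs)
  simpa using this

variable {X : Type*} [MetricSpace X] {f : X → EReal} {K N : ℝ} {T : EReal}

/-! ### Time intervals and real values of the functional -/

lemma isOpen_timeInterval (T : EReal) : IsOpen (timeInterval T) :=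
  (isOpen_lt continuous_const continuous_id).inter
    (isOpen_lt continuous_coe_real_ereal continuous_const)

lemma timeInterval_of_le {s t : ℝ} (ht : t ∈ timeInterval T) (hs : 0 < s) (hst : s ≤ t) :
    s ∈ timeInterval T :=
  ⟨hs, (EReal.coe_le_coe_iff.2 hst).trans_lt ht.2⟩

lemma eventually_mem_timeInterval (hT : 0 < T) : ∀ᶠ t in 𝓝[>] (0 : ℝ), t ∈ timeInterval T := by
  obtain ⟨b, hb, hbT⟩ := EReal.lt_iff_exists_real_btwn.1 hT
  have hb0 : (0 : ℝ) < b := by exact_mod_cast hb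
  filter_upwards [Ioo_mem_nhdsGT hb0] with t ht
  exact timeInterval_of_le ⟨hb0, hbT⟩ ht.1 ht.2.le

lemma tendsto_sub_nhdsGT (t : ℝ) : Tendsto (fun s => s - t) (𝓝[>] t) (𝓝[>] 0) := by
  refine tendsto_nhdsWithin_iff.2 ⟨?_, ?_⟩
  · have : Continuous fun s : ℝ => s - t := by fun_prop
    simpa using (this.tendsto t).mono_left nhdsWithin_le_nhds
  · filter_upwards [self_mem_nhdsWithin] with s hs using mem_Ioi.2 (sub_pos.2 (mem_Ioi.1 hs))

lemma tendsto_add_nhdsGT (t : ℝ) : Tendsto (fun h => t + h) (𝓝[>] 0) (𝓝[>] t) := by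
  refine tendsto_nhdsWithin_iff.2 ⟨?_, ?_⟩
  · have : Continuous fun h : ℝ => t + h := by fun_prop
    simpa using (this.tendsto 0).mono_left nhdsWithin_le_nhds
  · filter_upwards [self_mem_nhdsWithin] with s hs
      using mem_Ioi.2 (lt_add_of_pos_right t (mem_Ioi.1 hs))

lemma toReal_expTransform {X : Type*} {f : X → EReal} {x : X} (hx : x ∈ finDomain f) :
    (expTransform N f x).toReal = Real.exp (-(f x).toReal / N) := by
  unfold expTransform
  conv_lhs => rw [← EReal.coe_toReal hx.2 hx.1]
  rw [← EReal.coe_neg, ← EReal.coe_div, EReal.exp_coe,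
    ENNReal.toReal_ofReal (Real.exp_pos _).le]

lemma LowerSemicontinuous.eventually_sub_lt_toReal (hf : LowerSemicontinuous f) {x : X}
    (hx : x ∈ finDomain f) {η : ℝ} (hη : 0 < η) :
    ∀ᶠ z in 𝓝 x, z ∈ finDomain f → (f x).toReal - η < (f z).toReal := by
  have h : (((f x).toReal - η : ℝ) : EReal) < f x := by
    conv_rhs => rw [← EReal.coe_toReal hx.2 hx.1]
    exact EReal.coe_lt_coe_iff.2 (by linarith)
  filter_upwards [hf x _ h] with z hz hzf
  rw [← EReal.coe_toReal hzf.2 hzf.1] at hz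
  exact EReal.coe_lt_coe_iff.1 hz

/-! ### The right-hand side of the evolution variational inequality -/

/-- The bound which the evolution variational inequality gives for the upper right derivative of
`r ↦ 𝔰_{K,N}(d(y_r, z) / 2)²`, in terms of `a = f (y_t)`, `b = f z` and `d = d(y_t, z)`. -/
noncomputable def eviBound (K N a b d : ℝ) : ℝ :=
  N / 2 * (1 - Real.exp ((a - b) / N)) - K * halfSinSq K N d

lemma continuous_eviBound (K N : ℝ) :
    Continuous fun p : ℝ × ℝ × ℝ => eviBound K N p.1 p.2.1 p.2.2 := by
  have := continuous_halfSinSq K N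
  unfold eviBound
  fun_prop

lemma eviBound_le_eviBound (hN : N < 0) {a b a' b' d : ℝ} (h : b - a ≤ b' - a') :
    eviBound K N a b d ≤ eviBound K N a' b' d := by
  unfold eviBound
  have h1 : (a - b) / N ≤ (a' - b') / N := div_le_div_of_nonpos_of_le hN.le (by linarith)
  have h2 := Real.exp_le_exp.2 h1
  nlinarith

/-- Second-order expansion of the exponential: to leading order the bound is half the difference of
the values of `f`, as in the classical EVI, and the remainder is quadratic. -/
lemma eviBound_le (hN : N < 0) {a b d V : ℝ} (hV : b - a ≤ V) (hVN : |V| ≤ -N)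
    (hd : halfSinSq K N d ≤ d ^ 2) :
    eviBound K N a b d ≤ V / 2 + V ^ 2 / (2 * (-N)) + |K| * d ^ 2 := by
  refine (eviBound_le_eviBound (a' := 0) (b' := V) hN (by simpa using hV)).trans ?_
  unfold eviBound
  have h1 : |V / (-N)| ≤ 1 := by
    rw [abs_div, abs_of_pos (by linarith : 0 < -N)]
    exact (div_le_one (by linarith)).2 hVN
  have h2 := (abs_le.1 (Real.abs_exp_sub_one_sub_id_le h1)).2
  have h3 : (0 - V) / N = V / (-N) := by rw [div_neg, zero_sub, neg_div]
  rw [h3]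
  have h4 : -K * halfSinSq K N d ≤ |K| * d ^ 2 :=
    mul_le_mul (neg_le_abs K) hd (halfSinSq_nonneg _ _ _) (abs_nonneg K)
  have h5 : (-N) / 2 * (Real.exp (V / -N) - 1) ≤ (-N) / 2 * (V / (-N) + (V / (-N)) ^ 2) := by
    apply mul_le_mul_of_nonneg_left _ (by linarith)
    linarith
  have h6 : (-N) / 2 * (V / (-N) + (V / (-N)) ^ 2) = V / 2 + V ^ 2 / (2 * (-N)) := by
    have hN' : -N ≠ 0 := by linarith
    generalize -N = n at hN'
    field_simp
  linarith

lemma IsEVICurve.rightSlopeLE {w : ℝ → X} (hw : IsEVICurve K N f T w) {t : ℝ}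
    (ht : t ∈ timeInterval T) {z : X} (hz : z ∈ finDomain f)
    (hK : K < 0 → dist (w t) z < Real.pi * √(N / K)) :
    RightSlopeLE (fun r => halfSinSq K N (dist (w r) z)) t
      (eviBound K N (f (w t)).toReal (f z).toReal (dist (w t) z)) := by
  have h := hw.evi t ht z (lt_top_iff_ne_top.2 hz.2) hK
  rw [toReal_expTransform hz, toReal_expTransform (hw.mem_finDomain t ht), ← Real.exp_sub] at h
  have e : -(f z).toReal / N - -(f (w t)).toReal / N
      = ((f (w t)).toReal - (f z).toReal) / N := by ring
  rw [e] at h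
  intro r hr
  have hlt : upperRightDeriv (fun r => genSin K N (dist (w r) z / 2) ^ 2) t < (r : EReal) := by
    generalize upperRightDeriv (fun r => genSin K N (dist (w r) z / 2) ^ 2) t = U at h ⊢
    induction U with
    | bot => exact EReal.bot_lt_coe r
    | top => exact absurd (top_le_iff.1 (EReal.top_add_coe _ ▸ h)) (EReal.coe_ne_top _)
    | coe u =>
      rw [← EReal.coe_add, EReal.coe_le_coe_iff] at h
      refine EReal.coe_lt_coe_iff.2 (lt_of_le_of_lt ?_ hr)
      unfold eviBound halfSinSq
      linarith
  have hev := eventually_lt_of_limsup_lt hlt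
  filter_upwards [(tendsto_sub_nhdsGT t).eventually hev] with s hs
  rw [add_sub_cancel] at hs
  rw [slope_def_field]
  exact EReal.coe_lt_coe_iff.1 hs

/-! ### Behaviour of an evolution variational inequality curve at its starting point -/

section Start

variable {τ : EReal} {w : ℝ → X} {x : X}

lemma StartsAt.tendsto_dist (h : StartsAt w x) (z : X) :
    Tendsto (fun r => dist (w r) z) (𝓝[>] 0) (𝓝 (dist x z)) :=
  Tendsto.dist h tendsto_const_nhds

lemma IsEVICurve.continuousOn_halfSinSq (hw : IsEVICurve K N f τ w) (z : X) :
    ContinuousOn (fun r => halfSinSq K N (dist (w r) z)) (timeInterval τ) :=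
  (continuous_halfSinSq K N).comp_continuousOn
    (continuous_dist.comp_continuousOn (hw.continuousOn.prodMk continuousOn_const))

lemma pi_mul_sqrt_pos (hN : N < 0) (hK : K < 0) : 0 < Real.pi * √(N / K) :=
  mul_pos Real.pi_pos (Real.sqrt_pos.2 (div_pos_of_neg_of_neg hN hK))

lemma eventually_dist_lt_pi_mul_sqrt (hN : N < 0) :
    ∀ᶠ d in 𝓝 (0 : ℝ), K < 0 → d < Real.pi * √(N / K) := by
  by_cases hK : K < 0
  · filter_upwards [eventually_lt_nhds (pi_mul_sqrt_pos hN hK)] with d hd _ using hd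
  · exact Eventually.of_forall fun d h => absurd h hK

/-- At its starting point `x`, the upper right derivative of the squared distance to `z` along an
evolution variational inequality curve satisfies the same bound as at later times. -/
lemma IsEVICurve.eventually_sub_le (hN : N < 0) (hf : LowerSemicontinuous f) (hτ : 0 < τ)
    (hw : IsEVICurve K N f τ w) (hwx : StartsAt w x) (hx : x ∈ finDomain f) {z : X}
    (hz : z ∈ finDomain f) (hK : K < 0 → dist x z < Real.pi * √(N / K)) {c : ℝ}
    (hc : eviBound K N (f x).toReal (f z).toReal (dist x z) < c) :
    ∀ᶠ h in 𝓝[>] (0 : ℝ),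
      halfSinSq K N (dist (w h) z) - halfSinSq K N (dist x z) ≤ c * h := by
  -- Lower semicontinuity only gives `f (w r) > f x - η`; the bound increases when its first value
  -- of `f` decreases, so `η` has to leave room below `c`.
  obtain ⟨η, hη, hηc⟩ : ∃ η > 0, ∀ᶠ d in 𝓝 (dist x z),
      eviBound K N ((f x).toReal - η) (f z).toReal d < c := by
    have h1 : ∀ᶠ p : ℝ × ℝ in 𝓝 (0, dist x z),
        eviBound K N ((f x).toReal - p.1) (f z).toReal p.2 < c := by
      have hcont : Continuous fun p : ℝ × ℝ =>
          eviBound K N ((f x).toReal - p.1) (f z).toReal p.2 :=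
        (continuous_eviBound K N).comp (by fun_prop :
          Continuous fun p : ℝ × ℝ => ((f x).toReal - p.1, (f z).toReal, p.2))
      exact hcont.continuousAt.eventually_lt continuousAt_const (by simpa using hc)
    rw [nhds_prod_eq] at h1
    have h2 := h1.curry
    obtain ⟨η, hη, hη'⟩ := ((h2.filter_mono nhdsWithin_le_nhds).and
      (self_mem_nhdsWithin : Ioi (0 : ℝ) ∈ 𝓝[>] 0)).exists
    exact ⟨η, hη', hη⟩
  have hadm : ∀ᶠ d in 𝓝 (dist x z), K < 0 → d < Real.pi * √(N / K) := by
    by_cases h : K < 0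
    · filter_upwards [eventually_lt_nhds (hK h)] with d hd _ using hd
    · exact Eventually.of_forall fun d h' => absurd h' h
  have hall : ∀ᶠ r in 𝓝[>] (0 : ℝ), r ∈ timeInterval τ ∧
      eviBound K N ((f x).toReal - η) (f z).toReal (dist (w r) z) < c ∧
      (K < 0 → dist (w r) z < Real.pi * √(N / K)) ∧
      (w r ∈ finDomain f → (f x).toReal - η < (f (w r)).toReal) := by
    filter_upwards [eventually_mem_timeInterval hτ, (hwx.tendsto_dist z).eventually hηc,
      (hwx.tendsto_dist z).eventually hadm,
      hwx.eventually (LowerSemicontinuous.eventually_sub_lt_toReal hf hx hη)]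
      with r h1 h2 h3 h4 using ⟨h1, h2, h3, h4⟩
  obtain ⟨r₁, hr₁, hr⟩ := (mem_nhdsGT_iff_exists_Ioo_subset).1 hall
  filter_upwards [Ioo_mem_nhdsGT hr₁] with h hh
  have key := sub_le_of_rightSlopeLE (u := fun r => halfSinSq K N (dist (w r) z))
    (B := fun r => c * r) (B' := fun _ => c) hh.1
    ((hw.continuousOn_halfSinSq z).mono fun r hr' => (hr ⟨hr'.1, hr'.2.trans_lt hh.2⟩).1)
    ((continuous_halfSinSq K N).continuousAt.tendsto.comp (hwx.tendsto_dist z))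
    (fun t => by simpa using (hasDerivAt_id t).const_mul c)
    (fun t ht => by
      obtain ⟨h1, h2, h3, h4⟩ := hr ⟨ht.1, ht.2.trans hh.2⟩
      refine (hw.rightSlopeLE h1 hz h3).mono (le_trans (eviBound_le_eviBound hN ?_) h2.le)
      have := h4 (hw.mem_finDomain t h1)
      linarith)
  simpa using key

/-- The metric speed at the starting point is at most the descending slope. -/
lemma IsEVICurve.eventually_dist_le (hN : N < 0) (hτ : 0 < τ) (hw : IsEVICurve K N f τ w)
    (hwx : StartsAt w x) (hx : x ∈ finDomain f) {L L' : ℝ} (hL : 0 < L) (hLL' : L < L')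
    (hslope : ∀ᶠ z in 𝓝 x, z ∈ finDomain f → (f x).toReal - (f z).toReal ≤ L * dist z x) :
    ∀ᶠ h in 𝓝[>] (0 : ℝ), dist (w h) x ≤ L' * h := by
  have hL'pos : 0 < L' := hL.trans hLL'
  -- Two intermediate slopes: `L₁` absorbs the error in linearizing the EVI bound, and the geometric
  -- mean `L₂` of `L₁` and `L'` makes `L₂ / κ = L'`, where `κ` is the loss in replacing `√(halfSinSq
  -- K N d)` by `d / 2`.
  set L₁ := (L + L') / 2 with hL₁
  set L₂ := √(L₁ * L') with hL₂
  have hL₁pos : 0 < L₁ := by positivity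
  have hL₂sq : L₂ ^ 2 = L₁ * L' := Real.sq_sqrt (by positivity)
  have hL₂pos : 0 < L₂ := Real.sqrt_pos.2 (by positivity)
  have hL₁₂ : L₁ < L₂ := by
    apply lt_of_pow_lt_pow_left₀ 2 hL₂pos.le
    rw [hL₂sq]; nlinarith
  set κ := L₁ / L₂ with hκ
  have hκpos : 0 < κ := by positivity
  have hκ1 : κ < 1 := (div_lt_one hL₂pos).2 hL₁₂
  have hscal : ∀ᶠ d in 𝓝[>] (0 : ℝ), eviBound K N (-(L * d)) 0 d < L₁ / 2 * d := by
    have hq : HasDerivAt (halfSinSq K N) 0 0 := by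
      have h0 : HasDerivAt (genSin K N) 1 (id (0 : ℝ) / 2) := by
        simpa using hasDerivAt_genSin_zero hN
      have := (h0.comp (0 : ℝ) ((hasDerivAt_id (0 : ℝ)).div_const 2)).pow 2
      refine this.congr_deriv ?_
      simp [genSin_zero]
    have hd : HasDerivAt (fun d => eviBound K N (-(L * d)) 0 d) (L / 2) 0 := by
      unfold eviBound
      have h1 : HasDerivAt (fun d : ℝ => (-(L * d) - 0) / N) (-L / N) 0 := by
        have := ((((hasDerivAt_id (0 : ℝ)).const_mul L).neg).sub_const 0).div_const N
        simpa using this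
      have := ((h1.exp.const_sub 1).const_mul (N / 2)).sub (hq.const_mul K)
      refine this.congr_deriv ?_
      have hN0 := hN.ne
      simp only [mul_zero, neg_zero, sub_zero, zero_div, Real.exp_zero, one_mul]
      field_simp
    have hlim := hd.hasDerivWithinAt (s := Ioi 0)
    rw [hasDerivWithinAt_iff_tendsto_slope' (by simp)] at hlim
    filter_upwards [hlim.eventually_lt_const (by linarith : L / 2 < L₁ / 2), self_mem_nhdsWithin]
      with d hd hd0
    have hd0' : (0 : ℝ) < d := hd0
    rw [slope_lt_iff hd0] at hd
    simpa [eviBound] using hd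
  have hlow : ∀ᶠ d in 𝓝[>] (0 : ℝ), κ ^ 2 * d ^ 2 / 4 ≤ halfSinSq K N d := by
    have hpos : 0 < (1 - κ ^ 2) / 4 := by nlinarith
    filter_upwards [(eventually_abs_halfSinSq_sub_le (K := K) hN hpos).filter_mono
      nhdsWithin_le_nhds] with d hd
    have := (abs_le.1 hd).1
    linarith
  obtain ⟨ρ, hρ, hρd⟩ := mem_nhdsGT_iff_exists_Ioo_subset.1 (hscal.and hlow)
  have hd0 : Tendsto (fun r => dist (w r) x) (𝓝[>] 0) (𝓝 0) := by
    simpa using hwx.tendsto_dist x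
  have hall : ∀ᶠ r in 𝓝[>] (0 : ℝ), r ∈ timeInterval τ ∧ dist (w r) x < ρ ∧
      (K < 0 → dist (w r) x < Real.pi * √(N / K)) ∧
      (w r ∈ finDomain f → (f x).toReal - (f (w r)).toReal ≤ L * dist (w r) x) := by
    filter_upwards [eventually_mem_timeInterval hτ, hd0.eventually_lt_const hρ,
      hd0.eventually (eventually_dist_lt_pi_mul_sqrt hN), hwx.eventually hslope]
      with r h1 h2 h3 h4 using ⟨h1, h2, h3, h4⟩
  obtain ⟨r₁, hr₁, hr⟩ := (mem_nhdsGT_iff_exists_Ioo_subset).1 hall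
  filter_upwards [Ioo_mem_nhdsGT hr₁] with h hh
  -- Barrier argument for `(L₂/2 · r + η)²`. The strict derivative inequality is needed only where
  -- the two functions touch; there the barrier is positive because of `η`, so the distance is
  -- positive and the linearized bound applies.
  have hqle : √(halfSinSq K N (dist (w h) x)) ≤ L₂ / 2 * h := by
    refine le_of_forall_pos_le_add fun η hη => ?_
    have hq0 : Tendsto (fun r => halfSinSq K N (dist (w r) x)) (𝓝[>] 0) (𝓝 0) := by
      have := (continuous_halfSinSq K N).continuousAt.tendsto.comp hd0
      simpa [Function.comp_def] using this
    have hIoo : ∀ᶠ r in 𝓝[>] (0 : ℝ), r ∈ Ioo 0 h := Ioo_mem_nhdsGT hh.1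
    obtain ⟨a, ha, haη⟩ := (hIoo.and
      (hq0.eventually_lt_const (by positivity : 0 < η ^ 2))).exists
    have hB : ∀ r, HasDerivAt (fun r : ℝ => (L₂ / 2 * r + η) ^ 2) (L₂ * (L₂ / 2 * r + η)) r := by
      intro r
      have := (((hasDerivAt_id r).const_mul (L₂ / 2)).add_const η).pow 2
      refine this.congr_deriv ?_
      simp
      ring
    have key := image_le_of_liminf_slope_right_lt_deriv_boundary'
      (f := fun r => halfSinSq K N (dist (w r) x))
      (f' := fun r => eviBound K N (f (w r)).toReal (f x).toReal (dist (w r) x))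
      (a := a) (b := h) (B := fun r => (L₂ / 2 * r + η) ^ 2)
      (B' := fun r => L₂ * (L₂ / 2 * r + η))
      ((hw.continuousOn_halfSinSq x).mono fun r hr' =>
        (hr ⟨ha.1.trans_le hr'.1, hr'.2.trans_lt hh.2⟩).1)
      (fun r hr' s hs => by
        obtain ⟨h1, -, h3, -⟩ := hr ⟨ha.1.trans_le hr'.1, hr'.2.trans hh.2⟩
        exact (hw.rightSlopeLE h1 hx h3 s hs).frequently)
      (haη.le.trans (pow_le_pow_left₀ hη.le
        (le_add_of_nonneg_left (mul_nonneg (by positivity) ha.1.le)) 2))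
      (by fun_prop) (fun r _ => (hB r).hasDerivWithinAt)
      (fun r hr' hEq => by
        have hr0 : 0 < r := ha.1.trans_le hr'.1
        obtain ⟨h1, h2, -, h4⟩ := hr ⟨hr0, hr'.2.trans hh.2⟩
        have hpos : 0 < L₂ / 2 * r + η := by positivity
        have hdpos : 0 < dist (w r) x := by
          refine lt_of_le_of_ne dist_nonneg fun h0 => ?_
          simp only [← h0, halfSinSq_zero] at hEq
          exact (pow_pos hpos 2).ne hEq
        obtain ⟨hs1, hs2⟩ := hρd ⟨hdpos, h2⟩
        have hκd : κ * dist (w r) x / 2 ≤ L₂ / 2 * r + η := by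
          apply le_of_sq_le_sq _ hpos.le
          rw [← hEq]
          linarith
        have h5 : L₁ * dist (w r) x / 2 ≤ L₂ * (L₂ / 2 * r + η) := by
          have : L₁ = L₂ * κ := by rw [hκ]; field_simp
          rw [this]
          nlinarith
        have h6 := h4 (hw.mem_finDomain r h1)
        calc _ ≤ eviBound K N (-(L * dist (w r) x)) 0 (dist (w r) x) :=
              eviBound_le_eviBound hN (by linarith)
          _ < L₁ / 2 * dist (w r) x := hs1
          _ ≤ _ := by linarith)
      (right_mem_Icc.2 ha.2.le)
    exact Real.sqrt_le_iff.2 ⟨add_nonneg (mul_nonneg (by positivity) hh.1.le) hη.le, key⟩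
  rcases (dist_nonneg (x := w h) (y := x)).eq_or_lt with h0 | hdpos
  · rw [← h0]; exact mul_nonneg (by linarith) hh.1.le
  · have hs2 := (hρd ⟨hdpos, (hr hh).2.1⟩).2
    have h1 : κ * dist (w h) x / 2 ≤ L₂ / 2 * h := by
      refine le_trans (Real.le_sqrt_of_sq_le ?_) hqle
      linarith
    have h2 : L₁ * dist (w h) x ≤ L₁ * (L' * h) := by
      have h3 : L₁ = L₂ * κ := by rw [hκ]; field_simp
      calc L₁ * dist (w h) x = 2 * L₂ * (κ * dist (w h) x / 2) := by rw [h3]; ring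
        _ ≤ 2 * L₂ * (L₂ / 2 * h) := by gcongr
        _ = L₂ ^ 2 * h := by ring
        _ = L₁ * (L' * h) := by rw [hL₂sq]; ring
    exact le_of_mul_le_mul_left h2 hL₁pos

end Start

/-! ### Tangency of curves of maximal slope to evolution variational inequality curves -/

section Tangency

variable {τ : EReal} {w v : ℝ → X} {x : X}

/-- A curve `v` through `x` whose speed and whose rate of dissipation satisfy the energy
dissipation inequality at `x` is tangent to the evolution variational inequality curve starting
at `x`. -/
lemma IsEVICurve.eventually_dist_le_mul (hN : N < 0) (hτ : 0 < τ) (hw : IsEVICurve K N f τ w)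
    (hwx : StartsAt w x) (hx : x ∈ finDomain f) {L m P : ℝ} (hL : 0 ≤ L) (hm : 0 ≤ m)
    (hP : m ^ 2 / 2 + L ^ 2 / 2 ≤ P)
    (hslope : ∀ e > 0, ∀ᶠ z in 𝓝 x, z ∈ finDomain f →
      (f x).toReal - (f z).toReal ≤ (L + e) * dist z x)
    (hv : ∀ᶠ h in 𝓝[>] (0 : ℝ), v h ∈ finDomain f)
    (hvm : ∀ e > 0, ∀ᶠ h in 𝓝[>] (0 : ℝ), dist (v h) x ≤ (m + e) * h)
    (hvP : ∀ e > 0, ∀ᶠ h in 𝓝[>] (0 : ℝ), (f (v h)).toReal ≤ (f x).toReal - (P - e) * h)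
    {ε : ℝ} (hε : 0 < ε) :
    ∀ᶠ h in 𝓝[>] (0 : ℝ), dist (w h) (v h) ≤ ε * h := by
  -- At `e = 0` the left side is `m²/4 + L²/4 - P/2 ≤ 0` by `hP`, so a small `e` works by
  -- continuity. The `8` matches the lower bound `d² / 8 ≤ halfSinSq K N d` below.
  obtain ⟨e, he, he1, hbr⟩ : ∃ e > 0, e < 1 ∧
      (1 / 4 + e) * (m + e) ^ 2 - P / 2 + e + (L + e) ^ 2 / 4 < ε ^ 2 / 8 := by
    have hcont : Continuous fun e : ℝ =>
        (1 / 4 + e) * (m + e) ^ 2 - P / 2 + e + (L + e) ^ 2 / 4 := by fun_prop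
    have h1 : ∀ᶠ e in 𝓝 (0 : ℝ),
        (1 / 4 + e) * (m + e) ^ 2 - P / 2 + e + (L + e) ^ 2 / 4 < ε ^ 2 / 8 := by
      refine hcont.continuousAt.eventually_lt continuousAt_const ?_
      have : 0 < ε ^ 2 := by positivity
      simp only [add_zero]
      linarith
    obtain ⟨e, ⟨h1, h2⟩, h3⟩ := (((h1.and (eventually_lt_nhds one_pos)).filter_mono
      nhdsWithin_le_nhds).and (self_mem_nhdsWithin : Ioi (0 : ℝ) ∈ 𝓝[>] 0)).exists
    exact ⟨e, h3, h2, h1⟩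
  set M := L + e with hM
  have hMpos : 0 < M := by positivity
  -- For times up to `h`, `C₁ h` bounds the relevant difference of values of `f`, `C₂ h` the
  -- distance to `v h`, and `C₃ h²` the quadratic errors in the EVI.
  set C₁ := |P - e| + M ^ 2 with hC₁
  set C₂ := M + (m + e) with hC₂
  have hC₁0 : 0 ≤ C₁ := by positivity
  have hC₂0 : 0 ≤ C₂ := by positivity
  set C₃ := C₁ ^ 2 / (2 * (-N)) + |K| * C₂ ^ 2 with hC₃
  have hn : 0 < -N := by linarith
  have hC₃0 : 0 ≤ C₃ := by positivity
  -- the range of distances on which the comparison function is close to `d ^ 2 / 4`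
  obtain ⟨ρ, hρ, hρd⟩ : ∃ ρ > 0, ∀ d, 0 ≤ d → d < ρ →
      halfSinSq K N d ≤ (1 / 4 + e) * d ^ 2 ∧ halfSinSq K N d ≤ d ^ 2 ∧
      d ^ 2 / 8 ≤ halfSinSq K N d ∧ (K < 0 → d < Real.pi * √(N / K)) := by
    have hall := ((eventually_abs_halfSinSq_sub_le (K := K) hN he).and
      ((eventually_abs_halfSinSq_sub_le (K := K) hN (by norm_num : (0 : ℝ) < 1 / 8)).and
        (eventually_dist_lt_pi_mul_sqrt (K := K) hN)))
    obtain ⟨ρ, hρ, h⟩ := Metric.eventually_nhds_iff.1 hall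
    refine ⟨ρ, hρ, fun d hd0 hd => ?_⟩
    obtain ⟨h1, h2, h3⟩ := h (y := d) (by rwa [Real.dist_eq, sub_zero, abs_of_nonneg hd0])
    have h1' := abs_le.1 h1
    have h2' := abs_le.1 h2
    have : 0 ≤ d ^ 2 := sq_nonneg d
    exact ⟨by linarith, by linarith, by linarith, h3⟩
  have hdist := hw.eventually_dist_le hN hτ hwx hx (by positivity : 0 < L + e / 2)
    (by linarith : L + e / 2 < M) (hslope (e / 2) (by positivity))
  have hall : ∀ᶠ r in 𝓝[>] (0 : ℝ), r ∈ timeInterval τ ∧ dist (w r) x ≤ M * r ∧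
      (w r ∈ finDomain f → (f x).toReal - (f (w r)).toReal ≤ M * dist (w r) x) := by
    filter_upwards [eventually_mem_timeInterval hτ, hdist, hwx.eventually (hslope e he)]
      with r h1 h2 h3 using ⟨h1, h2, h3⟩
  obtain ⟨r₁, hr₁, hr⟩ := (mem_nhdsGT_iff_exists_Ioo_subset).1 hall
  have hsmall : ∀ C c : ℝ, 0 < c → ∀ᶠ h in 𝓝[>] (0 : ℝ), C * h < c := by
    intro C c hc
    have h1 : Tendsto (fun h : ℝ => C * h) (𝓝[>] 0) (𝓝 0) := by
      have : Continuous fun h : ℝ => C * h := by fun_prop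
      simpa using (this.tendsto 0).mono_left nhdsWithin_le_nhds
    exact h1.eventually_lt_const hc
  filter_upwards [Ioo_mem_nhdsGT hr₁, hv, hvm e he, hvP e he, hsmall C₂ ρ hρ, hsmall C₁ _ hn,
    hsmall C₃ (e / 2) (by positivity)] with h hh hvh hvmh hvPh hC₂h hC₁h hC₃h
  have hh0 : 0 < h := hh.1
  have hd : ∀ r ∈ Ioc 0 h, dist (w r) (v h) ≤ C₂ * h := by
    intro r hr'
    obtain ⟨h1, h2, h3⟩ := hr ⟨hr'.1, hr'.2.trans_lt hh.2⟩
    calc dist (w r) (v h) ≤ dist (w r) x + dist (v h) x := dist_triangle_right _ _ _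
      _ ≤ M * r + (m + e) * h := add_le_add h2 hvmh
      _ ≤ M * h + (m + e) * h := by gcongr; exact hr'.2
      _ = C₂ * h := by rw [hC₂]; ring
  -- The derivative in `r` is half of `-(P - e) h + M² r`, the bound for `f (v h) - f (w r)`, plus
  -- `e h / 2` for the quadratic errors.
  have hB : ∀ r, HasDerivAt (fun r : ℝ => (-(P - 2 * e) * h * r + M ^ 2 * r ^ 2 / 2) / 2)
      ((-(P - 2 * e) * h + M ^ 2 * r) / 2) r := by
    intro r
    have := ((((hasDerivAt_id r).const_mul (-(P - 2 * e) * h))).add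
      ((((hasDerivAt_id r).pow 2).const_mul (M ^ 2)).div_const 2)).div_const 2
    refine this.congr_deriv ?_
    simp
    ring
  have key := sub_le_of_rightSlopeLE (u := fun r => halfSinSq K N (dist (w r) (v h)))
    (u₀ := halfSinSq K N (dist x (v h))) hh0
    ((hw.continuousOn_halfSinSq (v h)).mono fun r hr' => (hr ⟨hr'.1, hr'.2.trans_lt hh.2⟩).1)
    ((continuous_halfSinSq K N).continuousAt.tendsto.comp (hwx.tendsto_dist (v h))) hB
    (fun r hr' => by
      obtain ⟨h1, h2, h3⟩ := hr ⟨hr'.1, hr'.2.trans hh.2⟩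
      have hdr := hd r ⟨hr'.1, hr'.2.le⟩
      obtain ⟨-, hq, -, hadm⟩ := hρd _ dist_nonneg (hdr.trans_lt hC₂h)
      refine (hw.rightSlopeLE h1 hvh hadm).mono ?_
      set V := -(P - e) * h + M ^ 2 * r with hV
      have h4 := h3 (hw.mem_finDomain r h1)
      have h5 : (f (v h)).toReal - (f (w r)).toReal ≤ V := by
        have : M * dist (w r) x ≤ M * (M * r) := by gcongr
        rw [hV]
        linarith
      have hVabs : |V| ≤ C₁ * h := by
        calc |V| ≤ |-(P - e) * h| + |M ^ 2 * r| := abs_add_le _ _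
          _ = |P - e| * h + M ^ 2 * r := by
            rw [abs_mul (-(P - e)) h, abs_neg, abs_of_pos hh0,
              abs_of_nonneg (mul_nonneg (sq_nonneg M) hr'.1.le)]
          _ ≤ |P - e| * h + M ^ 2 * h := by gcongr; exact hr'.2.le
          _ = C₁ * h := by rw [hC₁]; ring
      have h6 := eviBound_le (K := K) hN h5 (hVabs.trans hC₁h.le) hq
      have h7 : V ^ 2 ≤ (C₁ * h) ^ 2 := by
        rw [← sq_abs V]
        gcongr
      have h8 : dist (w r) (v h) ^ 2 ≤ (C₂ * h) ^ 2 := by gcongr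
      have h9 : V ^ 2 / (2 * (-N)) + |K| * dist (w r) (v h) ^ 2 ≤ e / 2 * h := by
        calc _ ≤ (C₁ * h) ^ 2 / (2 * (-N)) + |K| * (C₂ * h) ^ 2 := by gcongr
          _ = C₃ * h * h := by rw [hC₃]; ring
          _ ≤ e / 2 * h := by gcongr
      calc _ ≤ V / 2 + V ^ 2 / (2 * (-N)) + |K| * dist (w r) (v h) ^ 2 := h6
        _ ≤ V / 2 + e / 2 * h := by linarith
        _ = (-(P - 2 * e) * h + M ^ 2 * r) / 2 := by rw [hV]; ring)
  have hq0 : halfSinSq K N (dist x (v h)) ≤ (1 / 4 + e) * ((m + e) * h) ^ 2 := by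
    rw [dist_comm]
    have h1 : dist (v h) x < ρ := by
      refine lt_of_le_of_lt (hvmh.trans ?_) hC₂h
      gcongr
      rw [hC₂]; linarith
    refine (hρd _ dist_nonneg h1).1.trans ?_
    gcongr
  have hq1 := (hρd _ dist_nonneg ((hd h ⟨hh0, le_rfl⟩).trans_lt hC₂h)).2.2.1
  have hfin : dist (w h) (v h) ^ 2 ≤ (ε * h) ^ 2 := by
    have h1 : dist (w h) (v h) ^ 2 / 8 ≤
        ((1 / 4 + e) * (m + e) ^ 2 - P / 2 + e + M ^ 2 / 4) * h ^ 2 := by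
      simp only [mul_zero, ne_eq, OfNat.ofNat_ne_zero, not_false_eq_true, zero_pow, zero_div,
        add_zero, sub_zero] at key
      nlinarith
    have h2 : ((1 / 4 + e) * (m + e) ^ 2 - P / 2 + e + M ^ 2 / 4) * h ^ 2 ≤ ε ^ 2 / 8 * h ^ 2 := by
      gcongr
    rw [mul_pow]
    linarith
  exact le_of_sq_le_sq hfin (by positivity)

/-- Consequently such a curve inherits the evolution variational inequality at `x`. -/
lemma IsEVICurve.eventually_sub_le_of_tangent (hN : N < 0) (hf : LowerSemicontinuous f)
    (hτ : 0 < τ) (hw : IsEVICurve K N f τ w) (hwx : StartsAt w x) (hx : x ∈ finDomain f)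
    (hv : Tendsto v (𝓝[>] 0) (𝓝 x))
    (hwv : ∀ ε > 0, ∀ᶠ h in 𝓝[>] (0 : ℝ), dist (w h) (v h) ≤ ε * h)
    {z : X} (hz : z ∈ finDomain f) (hK : K < 0 → dist x z < Real.pi * √(N / K)) {c : ℝ}
    (hc : eviBound K N (f x).toReal (f z).toReal (dist x z) < c) :
    ∀ᶠ h in 𝓝[>] (0 : ℝ),
      halfSinSq K N (dist (v h) z) - halfSinSq K N (dist x z) < c * h := by
  obtain ⟨c', hc', hcc'⟩ := exists_between hc
  -- The comparison function is Lipschitz near `dist x z`, so replacing `w h` by `v h` costs only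
  -- `o(h)`, which fits in the gap between `c'` and `c`.
  obtain ⟨Q, S, hS, hQ⟩ :=
    (contDiff_halfSinSq K N).contDiffAt.exists_lipschitzOnWith (x := dist x z)
  set ε := (c - c') / (2 * (Q + 1)) with hε
  have hεpos : 0 < ε := div_pos (by linarith) (by positivity)
  filter_upwards [hw.eventually_sub_le hN hf hτ hwx hx hz hK hc', hwv ε hεpos,
    (hwx.tendsto_dist z).eventually_mem hS, (StartsAt.tendsto_dist hv z).eventually_mem hS,
    self_mem_nhdsWithin] with h h1 h2 h3 h4 h5
  have hh : 0 < h := h5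
  have h6 := hQ.dist_le_mul _ h4 _ h3
  rw [Real.dist_eq, Real.dist_eq] at h6
  have h7 : |dist (v h) z - dist (w h) z| ≤ ε * h := by
    refine (abs_dist_sub_le _ _ _).trans ?_
    rwa [dist_comm]
  have h8 : (Q : ℝ) * |dist (v h) z - dist (w h) z| ≤ (c - c') / 2 * h := by
    calc (Q : ℝ) * |dist (v h) z - dist (w h) z| ≤ (Q + 1) * (ε * h) := by
          gcongr; linarith
      _ = (c - c') / 2 * h := by rw [hε]; field_simp
  have h9 := (le_abs_self _).trans (h6.trans h8)
  nlinarith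

end Tangency

/-! ### Curves of maximal slope -/

lemma eventually_le_mul_dist_of_descendingSlope_lt {x : X} (hx : x ∈ finDomain f) {L : ℝ}
    (hL : descendingSlope f x < ENNReal.ofReal L) :
    ∀ᶠ z in 𝓝 x, z ∈ finDomain f → (f x).toReal - (f z).toReal ≤ L * dist z x := by
  have hLpos : 0 < L := ENNReal.ofReal_pos.1 (zero_le.trans_lt hL)
  have h := eventually_lt_of_limsup_lt hL
  rw [eventually_nhdsWithin_iff] at h
  filter_upwards [h] with z hz hzf
  rcases eq_or_ne z x with rfl | hne
  · simp
  · have h1 := (hz hne).le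
    have hd : edist z x ≠ 0 := by simpa [edist_eq_zero] using hne
    rw [ENNReal.div_le_iff hd (edist_ne_top _ _), edist_dist, ← ENNReal.ofReal_mul hLpos.le] at h1
    have h2 : f x - f z = (((f x).toReal - (f z).toReal : ℝ) : EReal) := by
      rw [EReal.coe_sub, EReal.coe_toReal hx.2 hx.1, EReal.coe_toReal hzf.2 hzf.1]
    rw [h2, EReal.toENNReal_of_ne_top (EReal.coe_ne_top _), EReal.toReal_coe] at h1
    exact (ENNReal.ofReal_le_ofReal_iff (by positivity)).1 h1

lemma eventually_dist_le_of_metricSpeed_lt {y : ℝ → X} {t m : ℝ}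
    (hm : metricSpeed y t < ENNReal.ofReal m) :
    ∀ᶠ h in 𝓝[>] (0 : ℝ), dist (y (t + h)) (y t) ≤ m * h := by
  have hmpos : 0 < m := ENNReal.ofReal_pos.1 (zero_le.trans_lt hm)
  have h := (eventually_lt_of_limsup_lt hm).filter_mono
    (nhdsWithin_mono (0 : ℝ) fun h (hh : 0 < h) => hh.ne')
  filter_upwards [h, self_mem_nhdsWithin] with s hs hs0
  have hs0' : (0 : ℝ) < s := hs0
  have h1 := hs.le
  rw [abs_of_pos hs0', ENNReal.div_le_iff (by simpa using hs0') ENNReal.ofReal_ne_top,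
    edist_dist, ← ENNReal.ofReal_mul hmpos.le] at h1
  exact (ENNReal.ofReal_le_ofReal_iff (by positivity)).1 h1

lemma continuousOn_of_absolutelyContinuousOnInterval {Y : Type*} [PseudoMetricSpace Y]
    {y : ℝ → Y} {a b : ℝ} (hy : AbsolutelyContinuousOnInterval y a b) :
    ContinuousOn y (uIcc a b) := by
  rw [absolutelyContinuousOnInterval_iff] at hy
  refine Metric.continuousOn_iff.2 fun t ht ε hε => ?_
  obtain ⟨δ, hδ, h⟩ := hy ε hε
  refine ⟨δ, hδ, fun s hs hst => ?_⟩
  have := h (1, fun _ => (s, t)) ⟨fun _ _ => ⟨hs, ht⟩, by simp⟩ (by simpa using hst)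
  simpa using this

lemma LocallyAC.continuousOn {Y : Type*} [PseudoMetricSpace Y] {y : ℝ → Y}
    (hy : LocallyAC T y) : ContinuousOn y (timeInterval T) := by
  intro t ht
  obtain ⟨b, htb, hbT⟩ := EReal.lt_iff_exists_real_btwn.1 ht.2
  have htb' : t < b := EReal.coe_lt_coe_iff.1 htb
  have h2 : t / 2 < t := half_lt_self ht.1
  have h := continuousOn_of_absolutelyContinuousOnInterval
    (hy (t / 2) (timeInterval_of_le ht (half_pos ht.1) h2.le) b ⟨ht.1.trans htb', hbT⟩)
  rw [uIcc_of_le (h2.trans htb').le] at h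
  exact (h.continuousAt (Icc_mem_nhds h2 htb')).continuousWithinAt

lemma AbsolutelyContinuousOnInterval.of_dist_le {Y Z : Type*} [PseudoMetricSpace Y]
    [PseudoMetricSpace Z] {y : ℝ → Y} {u : ℝ → Z} {a b C : ℝ}
    (hy : AbsolutelyContinuousOnInterval y a b)
    (hu : ∀ s ∈ uIcc a b, ∀ t ∈ uIcc a b, dist (u s) (u t) ≤ C * dist (y s) (y t)) :
    AbsolutelyContinuousOnInterval u a b := by
  have h := Tendsto.const_mul C hy
  rw [mul_zero] at h
  refine squeeze_zero' (Eventually.of_forall fun E => Finset.sum_nonneg fun i _ => dist_nonneg)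
    ?_ h
  filter_upwards [mem_inf_of_right (mem_principal_self _)] with E hE
  rw [Finset.mul_sum]
  exact Finset.sum_le_sum fun i hi => hu _ (hE.1 i hi).1 _ (hE.1 i hi).2

lemma AbsolutelyContinuousOnInterval.sub_le {u : ℝ → ℝ} {a b c : ℝ} (hab : a ≤ b)
    (hu : AbsolutelyContinuousOnInterval u a b)
    (hc : ∀ᵐ t : ℝ, t ∈ Ioo a b → deriv u t ≤ c) : u b - u a ≤ c * (b - a) := by
  rw [← hu.integral_deriv_eq_sub]
  have hae : ∀ᵐ t ∂(MeasureTheory.volume.restrict (Icc a b)), deriv u t ≤ c := by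
    rw [← MeasureTheory.restrict_Ioo_eq_restrict_Icc,
      MeasureTheory.ae_restrict_iff' measurableSet_Ioo]
    exact hc
  calc ∫ t in a..b, deriv u t ≤ ∫ _ in a..b, c :=
        intervalIntegral.integral_mono_ae_restrict hab hu.intervalIntegrable_deriv
          intervalIntegrable_const hae
    _ = c * (b - a) := by simp [mul_comm]

/-- Intervals with rational endpoints cover `(0, T)`, so countably many null sets suffice. -/
lemma LocallyAC.ae_differentiableAt {u : ℝ → ℝ} (hu : LocallyAC T u) :
    ∀ᵐ t : ℝ, t ∈ timeInterval T → DifferentiableAt ℝ u t := by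
  have h : ∀ p q : ℚ, ∀ᵐ t : ℝ, (p : ℝ) ∈ timeInterval T → (q : ℝ) ∈ timeInterval T →
      t ∈ uIcc (p : ℝ) q → DifferentiableAt ℝ u t := by
    intro p q
    by_cases hp : (p : ℝ) ∈ timeInterval T
    · by_cases hq : (q : ℝ) ∈ timeInterval T
      · filter_upwards [(hu p hp q hq).ae_differentiableAt] with t ht _ _ using ht
      · exact Eventually.of_forall fun t _ h => absurd h hq
    · exact Eventually.of_forall fun t h => absurd h hp
  filter_upwards [MeasureTheory.ae_all_iff.2 fun p => MeasureTheory.ae_all_iff.2 (h p)] with t ht htT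
  obtain ⟨p, hp0, hpt⟩ := exists_rat_btwn htT.1
  obtain ⟨b, htb, hbT⟩ := EReal.lt_iff_exists_real_btwn.1 htT.2
  obtain ⟨q, htq, hqb⟩ := exists_rat_btwn (EReal.coe_lt_coe_iff.1 htb)
  refine ht p q (timeInterval_of_le htT hp0 hpt.le)
    ⟨htT.1.trans htq, (EReal.coe_lt_coe_iff.2 hqb).trans hbT⟩ ?_
  rw [uIcc_of_le (hpt.trans htq).le]
  exact ⟨hpt.le, htq.le⟩

lemma RightSlopeLE.deriv_le {u : ℝ → ℝ} {t c : ℝ} (h : RightSlopeLE u t c)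
    (hu : DifferentiableAt ℝ u t) : deriv u t ≤ c := by
  have hlim := hu.hasDerivAt.hasDerivWithinAt (s := Ioi t)
  rw [hasDerivWithinAt_iff_tendsto_slope' (by simp)] at hlim
  exact le_of_forall_gt_imp_ge_of_dense fun r hr =>
    le_of_tendsto hlim ((h r hr).mono fun _ => le_of_lt)

lemma IsMaximalSlopeCurve.antitoneOn {y : ℝ → X} (hy : IsMaximalSlopeCurve f T y) :
    AntitoneOn (fun t => (f (y t)).toReal) (timeInterval T) := by
  intro a ha b hb hab
  have h := AbsolutelyContinuousOnInterval.sub_le (c := 0) hab (hy.locallyAC_comp a ha b hb) (by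
    filter_upwards [hy.energy_dissipation] with t ht htab
    have h1 := (EReal.coe_ennreal_nonneg _).trans
      (ht (timeInterval_of_le hb (ha.1.trans htab.1) htab.2.le))
    have h2 : (0 : ℝ) ≤ -deriv (fun r => (f (y r)).toReal) t := by exact_mod_cast h1
    linarith)
  simp only [zero_mul] at h
  simp only
  linarith

/-- A curve of maximal slope whose points are starting points of evolution variational inequality
curves satisfies the evolution variational inequality at almost every time. -/
lemma IsMaximalSlopeCurve.ae_rightSlopeLE (hN : N < 0) (hf : LowerSemicontinuous f) {y : ℝ → X}
    (hy : IsMaximalSlopeCurve f T y)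
    (hflow : ∀ t ∈ timeInterval T, ∃ τ : EReal, 0 < τ ∧ ∃ w : ℝ → X,
      IsEVICurve K N f τ w ∧ StartsAt w (y t)) :
    ∀ᵐ t : ℝ, t ∈ timeInterval T → ∀ z ∈ finDomain f,
      (K < 0 → dist (y t) z < Real.pi * √(N / K)) →
      RightSlopeLE (fun r => halfSinSq K N (dist (y r) z)) t
        (eviBound K N (f (y t)).toReal (f z).toReal (dist (y t) z)) := by
  filter_upwards [hy.energy_dissipation, hy.locallyAC_comp.ae_differentiableAt] with t hen hdiff ht
  obtain ⟨τ, hτ, w, hw, hwx⟩ := hflow t ht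
  have hx := hy.mem_finDomain t ht
  set P := -deriv (fun r => (f (y r)).toReal) t with hP
  have hfin : metricSpeed y t ^ 2 / 2 + descendingSlope f (y t) ^ 2 / 2 ≠ ⊤ := by
    intro h
    have := hen ht
    rw [h] at this
    exact EReal.coe_ne_top _ (top_le_iff.1 this)
  have hm : metricSpeed y t ≠ ⊤ := fun h => hfin (by simp [h, ENNReal.top_div])
  have hL : descendingSlope f (y t) ≠ ⊤ := fun h => hfin (by simp [h, ENNReal.top_div])
  obtain ⟨m, hm'⟩ : ∃ m : NNReal, (m : ℝ≥0∞) = metricSpeed y t := ⟨_, ENNReal.coe_toNNReal hm⟩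
  obtain ⟨L, hL'⟩ : ∃ L : NNReal, (L : ℝ≥0∞) = descendingSlope f (y t) :=
    ⟨_, ENNReal.coe_toNNReal hL⟩
  have hmLP : (m : ℝ) ^ 2 / 2 + (L : ℝ) ^ 2 / 2 ≤ P := by
    have h := hen ht
    rw [← hm', ← hL'] at h
    have e : (((m : ℝ≥0∞) ^ 2 / 2 + (L : ℝ≥0∞) ^ 2 / 2 : ℝ≥0∞) : EReal)
        = (((m : ℝ) ^ 2 / 2 + (L : ℝ) ^ 2 / 2 : ℝ) : EReal) := by
      have e1 : ((m : ℝ≥0∞) ^ 2 / 2 + (L : ℝ≥0∞) ^ 2 / 2 : ℝ≥0∞)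
          = ((m ^ 2 / 2 + L ^ 2 / 2 : NNReal) : ℝ≥0∞) := by
        push_cast [ENNReal.coe_div (two_ne_zero : (2 : NNReal) ≠ 0)]
        rfl
      rw [e1, EReal.coe_nnreal_eq_coe_real]
      simp
    rw [e] at h
    exact EReal.coe_le_coe_iff.1 h
  have hadd := tendsto_add_nhdsGT t
  have hcont : Tendsto (fun h => y (t + h)) (𝓝[>] 0) (𝓝 (y t)) :=
    ((hy.locallyAC.continuousOn.continuousAt
      ((isOpen_timeInterval T).mem_nhds ht)).tendsto.mono_left nhdsWithin_le_nhds).comp hadd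
  have hmem : ∀ᶠ s in 𝓝[>] t, s ∈ timeInterval T :=
    nhdsWithin_le_nhds ((isOpen_timeInterval T).mem_nhds ht)
  have hlt : ∀ (a : NNReal) (e : ℝ), 0 < e → (a : ℝ≥0∞) < ENNReal.ofReal ((a : ℝ) + e) := by
    intro a e he
    rw [ENNReal.lt_ofReal_iff_toReal_lt ENNReal.coe_ne_top]
    simpa using he
  -- The auxiliary curve `w` depends on `t` and is compared with `y` only to first order at that
  -- instant.
  have htan : ∀ ε > 0, ∀ᶠ h in 𝓝[>] (0 : ℝ), dist (w h) (y (t + h)) ≤ ε * h := by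
    intro ε hε
    refine hw.eventually_dist_le_mul (v := fun h => y (t + h)) hN hτ hwx hx L.2 m.2 hmLP
      (fun e he => eventually_le_mul_dist_of_descendingSlope_lt hx (hL' ▸ hlt L e he))
      (hadd.eventually (hmem.mono fun s hs => hy.mem_finDomain s hs))
      (fun e he => eventually_dist_le_of_metricSpeed_lt (hm' ▸ hlt m e he)) ?_ hε
    intro e he
    have hlim := (hdiff ht).hasDerivAt.hasDerivWithinAt (s := Ioi t)
    rw [hasDerivWithinAt_iff_tendsto_slope' (by simp)] at hlim
    have h1 := hlim.eventually_lt_const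
      (by linarith : deriv (fun r => (f (y r)).toReal) t < -(P - e))
    filter_upwards [hadd.eventually h1, self_mem_nhdsWithin] with h h2 h3
    rw [slope_lt_iff (lt_add_of_pos_right t h3)] at h2
    linarith
  intro z hz hK r hr
  have h := hw.eventually_sub_le_of_tangent (v := fun h => y (t + h)) hN hf hτ hwx hx hcont htan
    hz hK hr
  filter_upwards [(tendsto_sub_nhdsGT t).eventually h, self_mem_nhdsWithin] with s hs hts
  rw [slope_lt_iff hts]
  simpa using hs

/-- Integration of an almost everywhere evolution variational inequality along a locally
absolutely continuous curve. -/
lemma LocallyAC.halfSinSq_sub_le {y : ℝ → X} (hy : LocallyAC T y) {z : X} {a b c : ℝ}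
    (ha : a ∈ timeInterval T) (hb : b ∈ timeInterval T) (hab : a ≤ b)
    (hc : ∀ᵐ t : ℝ, t ∈ Ioo a b →
      RightSlopeLE (fun r => halfSinSq K N (dist (y r) z)) t c) :
    halfSinSq K N (dist (y b) z) - halfSinSq K N (dist (y a) z) ≤ c * (b - a) := by
  have hyc : ContinuousOn (fun r => dist (y r) z) (uIcc a b) :=
    continuous_dist.comp_continuousOn
      ((continuousOn_of_absolutelyContinuousOnInterval (hy a ha b hb)).prodMk continuousOn_const)
  obtain ⟨R, hR⟩ := isCompact_uIcc.exists_bound_of_continuousOn hyc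
  obtain ⟨Q, hQ⟩ := (contDiff_halfSinSq K N).contDiffOn.exists_lipschitzOnWith (by decide)
    (convex_Icc 0 R) isCompact_Icc
  have hmem : ∀ r ∈ uIcc a b, dist (y r) z ∈ Icc 0 R := fun r hr =>
    ⟨dist_nonneg, (le_abs_self _).trans (hR r hr)⟩
  have hac : AbsolutelyContinuousOnInterval (fun r => halfSinSq K N (dist (y r) z)) a b := by
    refine AbsolutelyContinuousOnInterval.of_dist_le (C := Q) (hy a ha b hb) fun s hs t ht => ?_
    refine (hQ.dist_le_mul _ (hmem s hs) _ (hmem t ht)).trans ?_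
    gcongr
    exact abs_dist_sub_le _ _ _
  refine AbsolutelyContinuousOnInterval.sub_le hab hac ?_
  filter_upwards [hc, hac.ae_differentiableAt] with t h1 h2 ht
  exact (h1 ht).deriv_le (h2 (by rw [uIcc_of_le hab]; exact Ioo_subset_Icc_self ht))

/-! ### The functional along an evolution variational inequality curve -/

/-- Let `m` be a minimum point of `f ∘ w` on `[a, b]`. Tested at `w m`, the EVI after time `m` has
only the term in `K` left, so Gronwall forces `w` to stay at `w m`. Hence `w b` is a minimum point
of `f` along the curve. -/
lemma IsEVICurve.antitoneOn (hN : N < 0) (hf : LowerSemicontinuous f) {w : ℝ → X}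
    (hw : IsEVICurve K N f T w) : AntitoneOn (fun t => (f (w t)).toReal) (timeInterval T) := by
  intro a ha b hb hab
  have hsub : Icc a b ⊆ timeInterval T := fun r hr =>
    timeInterval_of_le hb (ha.1.trans_le hr.1) hr.2
  have hlsc : LowerSemicontinuousOn (fun t => f (w t)) (Icc a b) := fun t ht c hc =>
    (hw.continuousOn.mono hsub t ht).eventually (hf (w t) c hc)
  obtain ⟨m, hm, hmin⟩ := LowerSemicontinuousOn.exists_isMinOn ⟨a, left_mem_Icc.2 hab⟩
    isCompact_Icc hlsc
  have hmin' : ∀ r ∈ Icc a b, (f (w m)).toReal ≤ (f (w r)).toReal := fun r hr =>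
    EReal.toReal_le_toReal (hmin hr) (hw.mem_finDomain m (hsub hm)).1
      (hw.mem_finDomain r (hsub hr)).2
  have hmb : Icc m b ⊆ Icc a b := Icc_subset_Icc_left hm.1
  have hconst : Icc m b ⊆ {r | w r = w m} := by
    refine IsClosed.Icc_subset_of_forall_exists_gt ?_ rfl ?_
    · rw [inter_comm]
      exact (hw.continuousOn.mono (hmb.trans hsub)).preimage_isClosed_of_isClosed isClosed_Icc
        isClosed_singleton
    · rintro t ⟨htm, ht⟩ s hts
      have htm' : w t = w m := htm
      have htb := hmb (Ico_subset_Icc_self ht)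
      have hct : Tendsto w (𝓝 t) (𝓝 (w m)) := by
        rw [← htm']
        exact hw.continuousOn.continuousAt ((isOpen_timeInterval T).mem_nhds (hsub htb))
      have hd0 : Tendsto (fun r => dist (w r) (w m)) (𝓝[>] t) (𝓝 0) := by
        have : Tendsto (fun r => dist (w r) (w m)) (𝓝 t) (𝓝 (dist (w m) (w m))) :=
          hct.dist tendsto_const_nhds
        rw [dist_self] at this
        exact this.mono_left nhdsWithin_le_nhds
      have hall : ∀ᶠ r in 𝓝[>] t, r ∈ Ioc t (min s b) ∧
          (K < 0 → dist (w r) (w m) < Real.pi * √(N / K)) := by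
        filter_upwards [Ioc_mem_nhdsGT (lt_min hts ht.2),
          hd0.eventually (eventually_dist_lt_pi_mul_sqrt hN)] with r h1 h2 using ⟨h1, h2⟩
      obtain ⟨r₁, hr₁, hr⟩ := (mem_nhdsGT_iff_exists_Ioo_subset).1 hall
      obtain ⟨r₂, hr₂, hr₂₁⟩ := exists_between (mem_Ioi.1 hr₁)
      have hmem : ∀ r ∈ Ioc t r₂, r ∈ Icc a b := fun r hr' =>
        hmb ⟨ht.1.trans hr'.1.le,
          (hr ⟨hr'.1, hr'.2.trans_lt hr₂₁⟩).1.2.trans (min_le_right _ _)⟩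
      have key := nonpos_of_rightSlopeLE (C := -K)
        (u := fun r => halfSinSq K N (dist (w r) (w m))) (a := t) (b := r₂)
        ((hw.continuousOn_halfSinSq (w m)).mono fun r hr' => hsub (hmem r hr'))
        (by simpa [Function.comp_def] using
          (continuous_halfSinSq K N).continuousAt.tendsto.comp hd0)
        (fun r hr' => by
          have hrm := hmem r ⟨hr'.1, hr'.2.le⟩
          refine (hw.rightSlopeLE (hsub hrm) (hw.mem_finDomain m (hsub hm))
            (hr ⟨hr'.1, hr'.2.trans hr₂₁⟩).2).mono ?_
          refine (eviBound_le_eviBound (a' := 0) (b' := 0) hN ?_).trans_eq ?_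
          · linarith [hmin' r hrm]
          · simp [eviBound]) r₂ ⟨hr₂, le_rfl⟩
      have hr₂' := hr ⟨hr₂, hr₂₁⟩
      exact ⟨r₂, dist_eq_zero.1 (eq_zero_of_halfSinSq_eq_zero hN dist_nonneg hr₂'.2
        (le_antisymm key (halfSinSq_nonneg _ _ _))), hr₂, hr₂'.1.2.trans (min_le_left _ _)⟩
  have hb' : w b = w m := hconst ⟨hm.2, le_rfl⟩
  simp only [hb']
  exact hmin' a (left_mem_Icc.2 hab)

/-- Lower semicontinuity bounds the right limit from below, monotonicity from above. Right
continuity is what gives the time change a right derivative. -/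
lemma IsEVICurve.continuousWithinAt_toReal (hN : N < 0) (hf : LowerSemicontinuous f) {w : ℝ → X}
    (hw : IsEVICurve K N f T w) {t : ℝ} (ht : t ∈ timeInterval T) :
    ContinuousWithinAt (fun r => (f (w r)).toReal) (Ioi t) t := by
  have hmem : ∀ᶠ r in 𝓝[>] t, r ∈ timeInterval T :=
    nhdsWithin_le_nhds ((isOpen_timeInterval T).mem_nhds ht)
  refine tendsto_order.2 ⟨fun c hc => ?_, fun c hc => ?_⟩
  · have h := (hw.continuousOn.continuousAt ((isOpen_timeInterval T).mem_nhds ht)).eventually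
      (LowerSemicontinuous.eventually_sub_lt_toReal hf (hw.mem_finDomain t ht) (sub_pos.2 hc))
    filter_upwards [h.filter_mono nhdsWithin_le_nhds, hmem] with r h1 h2
    simpa using h1 (hw.mem_finDomain r h2)
  · filter_upwards [hmem, self_mem_nhdsWithin] with r h1 h2
    exact (hw.antitoneOn hN hf ht h1 (mem_Ioi.1 h2).le).trans_lt hc

/-! ### Time changes -/

section Primitive

variable {p : ℝ → ℝ} {a b : ℝ}

/-- Monotonicity bounds `p` by `p b`, so no control at `a` is needed: `f` may be infinite at the
common starting point. -/
lemma intervalIntegrable_of_monotoneOn_Ioc (hab : a < b) (hp : MonotoneOn p (Ioc a b))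
    (hp0 : ∀ t ∈ Ioc a b, 0 < p t) : IntervalIntegrable p MeasureTheory.volume a b := by
  rw [intervalIntegrable_iff_integrableOn_Ioc_of_le hab.le]
  refine ⟨(aemeasurable_restrict_of_monotoneOn measurableSet_Ioc hp).aestronglyMeasurable,
    .restrict_of_bounded (C := p b) measure_Ioc_lt_top ?_⟩
  rw [MeasureTheory.ae_restrict_iff' measurableSet_Ioc]
  refine Eventually.of_forall fun t ht => ?_
  rw [Real.norm_of_nonneg (hp0 t ht).le]
  exact hp ht (right_mem_Ioc.2 hab) ht.2

lemma continuousOn_primitive_of_monotoneOn_Ioc (hab : a < b) (hp : MonotoneOn p (Ioc a b))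
    (hp0 : ∀ t ∈ Ioc a b, 0 < p t) : ContinuousOn (fun s => ∫ r in a..s, p r) (Icc a b) := by
  have h := intervalIntegral.continuousOn_primitive_interval'
    (intervalIntegrable_of_monotoneOn_Ioc hab hp hp0) (left_mem_uIcc)
  rwa [uIcc_of_le hab.le] at h

lemma strictMonoOn_primitive_of_monotoneOn_Ioc (hab : a < b) (hp : MonotoneOn p (Ioc a b))
    (hp0 : ∀ t ∈ Ioc a b, 0 < p t) : StrictMonoOn (fun s => ∫ r in a..s, p r) (Icc a b) := by
  intro s hs t ht hst
  have hi := intervalIntegrable_of_monotoneOn_Ioc hab hp hp0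
  have hsub : ∀ {c d : ℝ}, c ∈ Icc a b → d ∈ Icc a b →
      IntervalIntegrable p MeasureTheory.volume c d := fun hc hd => by
    refine hi.mono_set ?_
    rw [uIcc_of_le hab.le]
    exact uIcc_subset_Icc hc hd
  have ha : a ∈ Icc a b := left_mem_Icc.2 hab.le
  have h1 := intervalIntegral.integral_interval_sub_left (hsub ha ht) (hsub ha hs)
  have h2 := intervalIntegral.intervalIntegral_pos_of_pos_on (hsub hs ht)
    (fun r hr => hp0 r ⟨hs.1.trans_lt hr.1, hr.2.le.trans ht.2⟩) hst
  simp only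
  linarith

lemma hasDerivWithinAt_primitive_of_monotoneOn_Ioc (hab : a < b) (hp : MonotoneOn p (Ioc a b))
    (hp0 : ∀ t ∈ Ioc a b, 0 < p t) {t : ℝ} (ht : t ∈ Ioo a b)
    (hpc : ContinuousWithinAt p (Ioi t) t) :
    HasDerivWithinAt (fun s => ∫ r in a..s, p r) (p t) (Ioi t) t := by
  have hi := intervalIntegrable_of_monotoneOn_Ioc hab hp hp0
  refine HasDerivWithinAt.mono ?_ Ioi_subset_Ici_self
  refine intervalIntegral.integral_hasDerivWithinAt_right (t := Ioi t) (hi.mono_set ?_) ?_ hpc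
  · rw [uIcc_of_le hab.le]
    exact uIcc_subset_Icc (left_mem_Icc.2 hab.le) (Ioo_subset_Icc_self ht)
  · refine ⟨Ioc a b, mem_nhdsWithin_of_mem_nhds (Ioc_mem_nhds ht.1 ht.2), ?_⟩
    exact (aemeasurable_restrict_of_monotoneOn measurableSet_Ioc hp).aestronglyMeasurable

end Primitive

/-- The time change `θ` with `∫_a^{θ t} p = ∫_a^t q`. -/
lemma exists_time_change {p q : ℝ → ℝ} {a b : ℝ} (hab : a < b)
    (hp : MonotoneOn p (Ioc a b)) (hp0 : ∀ t ∈ Ioc a b, 0 < p t)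
    (hq : MonotoneOn q (Ioc a b)) (hq0 : ∀ t ∈ Ioc a b, 0 < q t)
    (hpc : ∀ t ∈ Ioo a b, ContinuousWithinAt p (Ioi t) t)
    (hqc : ∀ t ∈ Ioo a b, ContinuousWithinAt q (Ioi t) t) :
    ∃ b' ∈ Ioc a b, ∃ θ : ℝ → ℝ, (∀ t ∈ Ioo a b', θ t ∈ Ioo a b) ∧
      StrictMonoOn θ (Ioo a b') ∧ ContinuousOn θ (Ioo a b') ∧ Tendsto θ (𝓝[>] a) (𝓝 a) ∧
      ∀ t ∈ Ioo a b', HasDerivWithinAt θ (q t / p (θ t)) (Ioi t) t := by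
  set A : ℝ → ℝ := fun s => ∫ r in a..s, p r with hA
  set B : ℝ → ℝ := fun s => ∫ r in a..s, q r with hB
  have hAc : ContinuousOn A (Icc a b) := continuousOn_primitive_of_monotoneOn_Ioc hab hp hp0
  have hBc : ContinuousOn B (Icc a b) := continuousOn_primitive_of_monotoneOn_Ioc hab hq hq0
  have hAm : StrictMonoOn A (Icc a b) := strictMonoOn_primitive_of_monotoneOn_Ioc hab hp hp0
  have hBm : StrictMonoOn B (Icc a b) := strictMonoOn_primitive_of_monotoneOn_Ioc hab hq hq0
  have hAa : A a = 0 := by simp [hA]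
  have hBa : B a = 0 := by simp [hB]
  have ha : a ∈ Icc a b := left_mem_Icc.2 hab.le
  have hb : b ∈ Icc a b := right_mem_Icc.2 hab.le
  -- Up to `b'` the values of `B` stay in the range of `A`, so `θ = A⁻¹ ∘ B` is defined.
  obtain ⟨b', hb', hBb'⟩ : ∃ b' ∈ Ioo a b, B b' < A b := by
    have h1 : Tendsto B (𝓝[>] a) (𝓝 (B a)) :=
      (hBc a ha).mono_left (nhdsWithin_le_of_mem (Icc_mem_nhdsGT hab))
    have h2 : B a < A b := by rw [hBa, ← hAa]; exact hAm ha hb hab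
    have h3 : ∀ᶠ s in 𝓝[>] a, s ∈ Ioo a b := Ioo_mem_nhdsGT hab
    obtain ⟨s, hs, hs'⟩ := (h3.and (h1.eventually_lt_const h2)).exists
    exact ⟨s, hs, hs'⟩
  have hsubI : Icc a b' ⊆ Icc a b := Icc_subset_Icc_right hb'.2.le
  have hex : ∀ t : ℝ, ∃ s, t ∈ Icc a b' → s ∈ Icc a b ∧ A s = B t := by
    intro t
    by_cases ht : t ∈ Icc a b'
    · have h1 : B t ∈ Icc (A a) (A b) := by
        constructor
        · rw [hAa, ← hBa]; exact hBm.monotoneOn ha (hsubI ht) ht.1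
        · exact (hBm.monotoneOn (hsubI ht) (Ioo_subset_Icc_self hb') ht.2).trans hBb'.le
      obtain ⟨s, hs, hs'⟩ := intermediate_value_Icc hab.le hAc h1
      exact ⟨s, fun _ => ⟨hs, hs'⟩⟩
    · exact ⟨a, fun h => absurd h ht⟩
  choose θ hθ using hex
  have hθm : StrictMonoOn θ (Icc a b') := by
    intro s hs t ht hst
    rw [← hAm.lt_iff_lt (hθ s hs).1 (hθ t ht).1, (hθ s hs).2, (hθ t ht).2]
    exact hBm (hsubI hs) (hsubI ht) hst
  have ha' : a ∈ Icc a b' := left_mem_Icc.2 hb'.1.le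
  have hθa : θ a = a := hAm.injOn (hθ a ha').1 ha (by rw [(hθ a ha').2, hAa, hBa])
  have hθIoo : ∀ t ∈ Ioo a b', θ t ∈ Ioo a b := by
    intro t ht
    have ht' := Ioo_subset_Icc_self ht
    refine ⟨?_, ?_⟩
    · have := hθm ha' ht' ht.1
      rwa [hθa] at this
    · rw [← hAm.lt_iff_lt (hθ t ht').1 hb, (hθ t ht').2]
      exact (hBm (hsubI ht') (Ioo_subset_Icc_self hb') ht.2).trans hBb'
  have hθc : ContinuousOn θ (Icc a b') := by
    intro t ht
    have hBt : Tendsto B (𝓝[Icc a b'] t) (𝓝 (B t)) := (hBc t (hsubI ht)).mono hsubI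
    refine tendsto_order.2 ⟨fun c hc => ?_, fun c hc => ?_⟩
    · rcases lt_or_ge c a with hca | hca
      · filter_upwards [self_mem_nhdsWithin] with r hr using hca.trans_le (hθ r hr).1.1
      · have hcI : c ∈ Icc a b := ⟨hca, hc.le.trans (hθ t ht).1.2⟩
        have h1 := hAm hcI (hθ t ht).1 hc
        rw [(hθ t ht).2] at h1
        filter_upwards [self_mem_nhdsWithin, hBt.eventually_const_lt h1] with r hr h2
        rwa [← hAm.lt_iff_lt hcI (hθ r hr).1, (hθ r hr).2]
    · rcases lt_or_ge b c with hcb | hcb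
      · filter_upwards [self_mem_nhdsWithin] with r hr using (hθ r hr).1.2.trans_lt hcb
      · have hcI : c ∈ Icc a b := ⟨(hθ t ht).1.1.trans hc.le, hcb⟩
        have h1 := hAm (hθ t ht).1 hcI hc
        rw [(hθ t ht).2] at h1
        filter_upwards [self_mem_nhdsWithin, hBt.eventually_lt_const h1] with r hr h2
        rwa [← hAm.lt_iff_lt (hθ r hr).1 hcI, (hθ r hr).2]
  refine ⟨b', Ioo_subset_Ioc_self hb', θ, hθIoo, hθm.mono Ioo_subset_Icc_self,
    hθc.mono Ioo_subset_Icc_self, ?_, fun t ht => ?_⟩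
  · have := (hθc a ha').mono_left (nhdsWithin_le_of_mem (Icc_mem_nhdsGT hb'.1))
    rwa [hθa] at this
  · have htb : t ∈ Ioo a b := ⟨ht.1, ht.2.trans hb'.2⟩
    have htI := Ioo_subset_Icc_self ht
    have hr : ∀ᶠ r in 𝓝[>] t, r ∈ Ioo t b' := Ioo_mem_nhdsGT ht.2
    have hrI : ∀ r ∈ Ioo t b', r ∈ Icc a b' := fun r hr => ⟨ht.1.le.trans hr.1.le, hr.2.le⟩
    have hA' := hasDerivWithinAt_primitive_of_monotoneOn_Ioc hab hp hp0 (hθIoo t ht)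
      (hpc _ (hθIoo t ht))
    have hB' := hasDerivWithinAt_primitive_of_monotoneOn_Ioc hab hq hq0 htb (hqc t htb)
    rw [hasDerivWithinAt_iff_tendsto_slope' (by simp)] at hA' hB' ⊢
    have hθt : Tendsto θ (𝓝[>] t) (𝓝[>] (θ t)) := by
      refine tendsto_nhdsWithin_iff.2 ⟨?_, ?_⟩
      · exact (hθc t htI).mono_left (nhdsWithin_le_of_mem (by
          filter_upwards [hr] with r hr using hrI r hr))
      · filter_upwards [hr] with r hr using hθm htI (hrI r hr) hr.1
    have hpne : p (θ t) ≠ 0 := (hp0 _ (Ioo_subset_Ioc_self (hθIoo t ht))).ne'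
    -- From `A ∘ θ = B`, the slope of `θ` is the quotient of those of `B` and `A`; strict
    -- monotonicity makes `θ r` approach `θ t` from the right, where `A` is differentiable.
    refine (hB'.div (hA'.comp hθt) hpne).congr' ?_
    filter_upwards [hr] with r hr
    have h1 : θ t < θ r := hθm htI (hrI r hr) hr.1
    have h2 : A (θ t) < A (θ r) := hAm (hθ t htI).1 (hθ r (hrI r hr)).1 h1
    have h3 : slope B t r / slope A (θ t) (θ r) = slope θ t r := by
      rw [slope_def_field, slope_def_field, slope_def_field, (hθ r (hrI r hr)).2, (hθ t htI).2]
      rw [(hθ r (hrI r hr)).2, (hθ t htI).2] at h2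
      have h4 : B r - B t ≠ 0 := (sub_pos.2 h2).ne'
      have h5 : θ r - θ t ≠ 0 := (sub_pos.2 h1).ne'
      have h6 : r - t ≠ 0 := (sub_pos.2 hr.1).ne'
      field_simp
    exact h3

/-! ### Comparison of the two curves -/

lemma monotoneOn_exp_toReal_div {X : Type*} {f : X → EReal} (hN : N < 0) {y : ℝ → X} {S : Set ℝ}
    (hy : AntitoneOn (fun t => (f (y t)).toReal) S) :
    MonotoneOn (fun t => Real.exp ((f (y t)).toReal / N)) S := fun _ hs _ ht hst =>
  Real.exp_le_exp.2 (div_le_div_of_nonpos_of_le hN.le (hy hs ht hst))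

lemma tendsto_eviBound {ι : Type*} {l : Filter ι} {u v d : ι → ℝ} {u₀ v₀ d₀ : ℝ}
    (hu : Tendsto u l (𝓝 u₀)) (hv : Tendsto v l (𝓝 v₀)) (hd : Tendsto d l (𝓝 d₀)) :
    Tendsto (fun i => eviBound K N (u i) (v i) (d i)) l (𝓝 (eviBound K N u₀ v₀ d₀)) := by
  unfold eviBound
  exact ((((hu.sub hv).div_const N).rexp.const_sub 1).const_mul (N / 2)).sub
    ((((continuous_halfSinSq K N).tendsto d₀).comp hd).const_mul K)

lemma eviBound_add_mul_eviBound (K N a b d : ℝ) :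
    eviBound K N a b d + Real.exp (a / N) / Real.exp (b / N) * eviBound K N b a d
      = -K * (1 + Real.exp (a / N) / Real.exp (b / N)) * halfSinSq K N d := by
  have h1 : Real.exp ((a - b) / N) = Real.exp (a / N) / Real.exp (b / N) := by
    rw [← Real.exp_sub, sub_div]
  have h2 : Real.exp ((b - a) / N) = (Real.exp (a / N) / Real.exp (b / N))⁻¹ := by
    rw [inv_div, ← Real.exp_sub, sub_div]
  have h3 : 0 < Real.exp (a / N) / Real.exp (b / N) := by positivity
  unfold eviBound
  rw [h1, h2]
  generalize Real.exp (a / N) / Real.exp (b / N) = κ at h3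
  field_simp
  ring

/-- The differential inequality for the distance between the curve of maximal slope, suitably
reparametrized, and the evolution variational inequality curve. -/
lemma rightSlopeLE_halfSinSq_timeChange (hN : N < 0) (hf : LowerSemicontinuous f)
    {y w : ℝ → X} {T' : EReal} {ϑ : ℝ → ℝ} {t b' : ℝ} (hy : IsMaximalSlopeCurve f T y)
    (hyE : ∀ᵐ t : ℝ, t ∈ timeInterval T → ∀ z ∈ finDomain f,
      (K < 0 → dist (y t) z < Real.pi * √(N / K)) →
      RightSlopeLE (fun r => halfSinSq K N (dist (y r) z)) t
        (eviBound K N (f (y t)).toReal (f z).toReal (dist (y t) z)))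
    (hw : IsEVICurve K N f T' w) (ht : t ∈ timeInterval T') (hϑt : ϑ t ∈ timeInterval T)
    (htb' : t < b') (hϑm : ∀ s ∈ Ioo t b', ϑ t < ϑ s)
    (hadm : K < 0 → dist (y (ϑ t)) (w t) < Real.pi * √(N / K))
    (hϑ : HasDerivWithinAt ϑ
      (Real.exp ((f (w t)).toReal / N) / Real.exp ((f (y (ϑ t))).toReal / N)) (Ioi t) t) :
    RightSlopeLE (fun s => halfSinSq K N (dist (y (ϑ s)) (w s))) t
      (-K * (1 + Real.exp ((f (w t)).toReal / N) / Real.exp ((f (y (ϑ t))).toReal / N))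
        * halfSinSq K N (dist (y (ϑ t)) (w t))) := by
  intro r hr
  have hyt := hy.mem_finDomain _ hϑt
  set a := (f (w t)).toReal with ha
  set b := (f (y (ϑ t))).toReal with hb
  set d := dist (y (ϑ t)) (w t) with hd
  rw [← eviBound_add_mul_eviBound] at hr
  set κ := Real.exp (a / N) / Real.exp (b / N) with hκ
  have hκ0 : 0 < κ := by positivity
  set g := r - (eviBound K N a b d + κ * eviBound K N b a d) with hg
  have hg0 : 0 < g := sub_pos.2 hr
  obtain ⟨c₁, hc₁, c₂, hc₂, hcr⟩ : ∃ c₁ > eviBound K N a b d, ∃ c₂ > eviBound K N b a d,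
      c₁ + c₂ * κ < r := by
    refine ⟨eviBound K N a b d + g / 3, by linarith, eviBound K N b a d + g / (3 * (κ + 1)),
      lt_add_of_pos_right _ (by positivity), ?_⟩
    have h1 : g / (3 * (κ + 1)) * κ ≤ g / 3 := by
      rw [div_mul_eq_mul_div, div_le_div_iff₀ (by positivity) (by positivity)]
      nlinarith
    linarith
  have hI : ∀ᶠ s in 𝓝[>] t, s ∈ timeInterval T' :=
    nhdsWithin_le_nhds ((isOpen_timeInterval T').mem_nhds ht)
  have hwt : Tendsto w (𝓝[>] t) (𝓝 (w t)) :=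
    (hw.continuousOn.continuousAt ((isOpen_timeInterval T').mem_nhds ht)).tendsto.mono_left
      nhdsWithin_le_nhds
  have hnhds := (isOpen_timeInterval T).mem_nhds hϑt
  -- the increment of `w`
  have hfirst : ∀ᶠ s in 𝓝[>] t, halfSinSq K N (dist (y (ϑ t)) (w s)) -
      halfSinSq K N (dist (y (ϑ t)) (w t)) < c₁ * (s - t) := by
    have h := hw.rightSlopeLE ht hyt (by rwa [dist_comm])
    filter_upwards [h c₁ (by rwa [dist_comm]), self_mem_nhdsWithin] with s hs hts
    rw [slope_lt_iff hts] at hs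
    simpa [dist_comm] using hs
  -- the increment of `y`
  have hsecond : ∀ᶠ s in 𝓝[>] t, halfSinSq K N (dist (y (ϑ s)) (w s)) -
      halfSinSq K N (dist (y (ϑ t)) (w s)) ≤ c₂ * (ϑ s - ϑ t) := by
    have hyc : Tendsto y (𝓝 (ϑ t)) (𝓝 (y (ϑ t))) := hy.locallyAC.continuousOn.continuousAt hnhds
    have hyf : Tendsto (fun s => (f (y s)).toReal) (𝓝 (ϑ t)) (𝓝 b) :=
      hy.locallyAC_comp.continuousOn.continuousAt hnhds
    have hwf : Tendsto (fun s => (f (w s)).toReal) (𝓝[>] t) (𝓝 a) :=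
      hw.continuousWithinAt_toReal hN hf ht
    -- The test point `w s` moves with `s` while the EVI for `y` is integrated over `[ϑ t, ϑ s]`, so
    -- the bound must hold jointly for both times near their limits.
    have hdist : Tendsto (fun p : ℝ × ℝ => dist (y p.1) (w p.2)) (𝓝 (ϑ t) ×ˢ 𝓝[>] t) (𝓝 d) :=
      (hyc.comp tendsto_fst).dist (hwt.comp tendsto_snd)
    have hlim : Tendsto (fun p : ℝ × ℝ => eviBound K N (f (y p.1)).toReal (f (w p.2)).toReal
        (dist (y p.1) (w p.2))) (𝓝 (ϑ t) ×ˢ 𝓝[>] t) (𝓝 (eviBound K N b a d)) :=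
      tendsto_eviBound (hyf.comp tendsto_fst) (hwf.comp tendsto_snd) hdist
    have hadm' : ∀ᶠ p : ℝ × ℝ in 𝓝 (ϑ t) ×ˢ 𝓝[>] t,
        K < 0 → dist (y p.1) (w p.2) < Real.pi * √(N / K) := by
      by_cases hK : K < 0
      · filter_upwards [hdist.eventually_lt_const (hadm hK)] with p hp _ using hp
      · exact Eventually.of_forall fun p h => absurd h hK
    obtain ⟨pa, hpa, pb, hpb, hpab⟩ :=
      eventually_prod_iff.1 ((hlim.eventually_lt_const hc₂).and hadm')
    obtain ⟨ε, hε, hεpa⟩ := Metric.eventually_nhds_iff.1 (hpa.and hnhds)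
    have hϑc : Tendsto ϑ (𝓝[>] t) (𝓝 (ϑ t)) := hϑ.continuousWithinAt
    filter_upwards [hpb, hI, Ioo_mem_nhdsGT htb',
      hϑc.eventually_lt_const (lt_add_of_pos_right (ϑ t) hε)] with s hs hsI hsb hsε
    have hmem : ∀ r ∈ Icc (ϑ t) (ϑ s), pa r ∧ r ∈ timeInterval T := fun r hr =>
      hεpa (by rw [Real.dist_eq, abs_of_nonneg (by linarith [hr.1])]; linarith [hr.2])
    have hϑts := hϑm s hsb
    refine hy.locallyAC.halfSinSq_sub_le hϑt (hmem _ ⟨hϑts.le, le_rfl⟩).2 hϑts.le ?_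
    filter_upwards [hyE] with r hr hrI
    obtain ⟨hpr, hrT⟩ := hmem r (Ioo_subset_Icc_self hrI)
    obtain ⟨h1, h2⟩ := hpab hpr hs
    exact (hr hrT (w s) (hw.mem_finDomain s hsI) h2).mono h1.le
  have hslope := hϑ
  rw [hasDerivWithinAt_iff_tendsto_slope' (by simp)] at hslope
  have hthird : ∀ᶠ s in 𝓝[>] t, c₁ + c₂ * slope ϑ t s < r :=
    (tendsto_const_nhds.add (hslope.const_mul c₂)).eventually_lt_const hcr
  filter_upwards [hfirst, hsecond, hthird, self_mem_nhdsWithin] with s h1 h2 h3 hts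
  have hts' : 0 < s - t := sub_pos.2 hts
  rw [slope_lt_iff hts]
  have h4 : slope ϑ t s * (s - t) = ϑ s - ϑ t := by
    rw [slope_def_field]; field_simp
  have h5 : (c₁ + c₂ * slope ϑ t s) * (s - t) < r * (s - t) := by gcongr
  have h6 : (c₁ + c₂ * slope ϑ t s) * (s - t) = c₁ * (s - t) + c₂ * (ϑ s - ϑ t) := by
    rw [← h4]; ring
  linarith

/-- Two curves which start at the same point at time `a` agree for a short time. -/
lemma exists_eqOn_Ioo (hN : N < 0) (hf : LowerSemicontinuous f) {y w : ℝ → X}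
    (hy : IsMaximalSlopeCurve f T y)
    (hflow : ∀ t ∈ timeInterval T, ∃ τ : EReal, 0 < τ ∧ ∃ w : ℝ → X,
      IsEVICurve K N f τ w ∧ StartsAt w (y t))
    (hw : IsEVICurve K N f T w) (hbdd : K < 0 → ∃ M : ℝ, ∀ x : X, f x ≤ (M : EReal))
    {a : ℝ} {p : X} (ha : 0 ≤ a) (haT : (a : EReal) < T) (hya : Tendsto y (𝓝[>] a) (𝓝 p))
    (hwa : Tendsto w (𝓝[>] a) (𝓝 p)) : ∃ b > a, EqOn y w (Ioo a b) := by
  have hyE := hy.ae_rightSlopeLE hN hf hflow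
  -- Half the admissible radius around `p` makes `y r` and `w s` admissible for each other even at
  -- different times, as the time change requires.
  obtain ⟨b, hab, hb⟩ : ∃ b > a, ∀ r ∈ Ioc a b, r ∈ timeInterval T ∧
      (K < 0 → dist (y r) p < Real.pi * √(N / K) / 2) ∧
      (K < 0 → dist (w r) p < Real.pi * √(N / K) / 2) := by
    obtain ⟨b₀, hb₀, hb₀T⟩ := EReal.lt_iff_exists_real_btwn.1 haT
    have hnear : ∀ {v : ℝ → X}, Tendsto v (𝓝[>] a) (𝓝 p) →
        ∀ᶠ r in 𝓝[>] a, K < 0 → dist (v r) p < Real.pi * √(N / K) / 2 := by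
      intro v hv
      by_cases hK : K < 0
      · have h : Tendsto (fun r => dist (v r) p) (𝓝[>] a) (𝓝 0) := by
          simpa using hv.dist (tendsto_const_nhds (x := p))
        filter_upwards [h.eventually_lt_const (half_pos (pi_mul_sqrt_pos hN hK))] with r hr _
          using hr
      · exact Eventually.of_forall fun r h => absurd h hK
    have hall : ∀ᶠ r in 𝓝[>] a, r ∈ timeInterval T ∧
        (K < 0 → dist (y r) p < Real.pi * √(N / K) / 2) ∧
        (K < 0 → dist (w r) p < Real.pi * √(N / K) / 2) := by
      filter_upwards [Ioo_mem_nhdsGT (EReal.coe_lt_coe_iff.1 hb₀), hnear hya, hnear hwa]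
        with r h1 h2 h3
      exact ⟨⟨ha.trans_lt h1.1, (EReal.coe_lt_coe_iff.2 h1.2).trans hb₀T⟩, h2, h3⟩
    exact (mem_nhdsGT_iff_exists_Ioc_subset).1 hall
  have hbI : Ioc a b ⊆ timeInterval T := fun r hr => (hb r hr).1
  have hdist : ∀ r ∈ Ioc a b, ∀ s ∈ Ioc a b, K < 0 → dist (y r) (w s) < Real.pi * √(N / K) := by
    intro r hr s hs hK
    have h1 := (hb r hr).2.1 hK
    have h2 := (hb s hs).2.2 hK
    linarith [dist_triangle_right (y r) (w s) p]
  have hym := hy.antitoneOn.mono hbI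
  have hwm := (hw.antitoneOn hN hf).mono hbI
  have hyc := hy.locallyAC_comp.continuousOn
  obtain ⟨b', hb', θ, hθI, hθm, hθc, hθa, hθd⟩ := exists_time_change hab
    (monotoneOn_exp_toReal_div hN hym) (fun t _ => Real.exp_pos _)
    (monotoneOn_exp_toReal_div hN hwm) (fun t _ => Real.exp_pos _)
    (fun t ht => (((hyc.continuousAt ((isOpen_timeInterval T).mem_nhds
      (hbI (Ioo_subset_Ioc_self ht)))).continuousWithinAt).div_const N).rexp)
    (fun t ht => (((hw.continuousWithinAt_toReal hN hf
      (hbI (Ioo_subset_Ioc_self ht)))).div_const N).rexp)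
  have hb'b : ∀ t ∈ Ioo a b', t ∈ Ioc a b := fun t ht => ⟨ht.1, ht.2.le.trans hb'.2⟩
  have hθI' : ∀ t ∈ Ioo a b', θ t ∈ Ioc a b := fun t ht => Ioo_subset_Ioc_self (hθI t ht)
  have heq : ∀ t ∈ Ioo a b', y (θ t) = w t := by
    intro t₀ ht₀
    have hsub : Ioc a t₀ ⊆ Ioo a b' := fun r hr => ⟨hr.1, hr.2.trans_lt ht₀.2⟩
    have hyθc : ContinuousOn (fun t => y (θ t)) (Ioc a t₀) :=
      hy.locallyAC.continuousOn.comp (hθc.mono hsub) fun r hr => hbI (hθI' r (hsub hr))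
    have hθa' : Tendsto θ (𝓝[>] a) (𝓝[>] a) := by
      refine tendsto_nhdsWithin_iff.2 ⟨hθa, ?_⟩
      filter_upwards [Ioo_mem_nhdsGT hb'.1] with r hr using (hθI r hr).1
    -- For `K < 0` the numerator is largest at `t₀` by monotonicity, and the bound `f ≤ M` keeps the
    -- denominator away from `0`; for `K ≥ 0` the coefficient is nonpositive.
    obtain ⟨C, hC⟩ : ∃ C, ∀ t ∈ Ioo a t₀,
        -K * (1 + Real.exp ((f (w t)).toReal / N) / Real.exp ((f (y (θ t))).toReal / N)) ≤ C := by
      by_cases hK : K < 0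
      · obtain ⟨M, hM⟩ := hbdd hK
        refine ⟨-K * (1 + Real.exp ((f (w t₀)).toReal / N) / Real.exp (M / N)), fun t ht => ?_⟩
        have htI := hsub (Ioo_subset_Ioc_self ht)
        have h1 : Real.exp ((f (w t)).toReal / N) ≤ Real.exp ((f (w t₀)).toReal / N) :=
          monotoneOn_exp_toReal_div hN hwm (hb'b t htI) (hb'b t₀ ht₀) ht.2.le
        have h2 : Real.exp (M / N) ≤ Real.exp ((f (y (θ t))).toReal / N) := by
          refine Real.exp_le_exp.2 (div_le_div_of_nonpos_of_le hN.le ?_)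
          exact EReal.toReal_le_toReal (hM _)
            (hy.mem_finDomain _ (hbI (hθI' t htI))).1 (EReal.coe_ne_top M)
        have hK' : 0 ≤ -K := by linarith
        gcongr
      · refine ⟨0, fun t _ => ?_⟩
        have h1 : 0 < 1 + Real.exp ((f (w t)).toReal / N) /
          Real.exp ((f (y (θ t))).toReal / N) := by positivity
        have hK' : 0 ≤ K := not_lt.1 hK
        nlinarith
    have key := nonpos_of_rightSlopeLE (C := C)
      (u := fun s => halfSinSq K N (dist (y (θ s)) (w s))) (a := a) (b := t₀)
      ((continuous_halfSinSq K N).comp_continuousOn (continuous_dist.comp_continuousOn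
        (hyθc.prodMk (hw.continuousOn.mono fun r hr => hbI (hb'b r (hsub hr))))))
      (by
        have h : Tendsto (fun s => dist (y (θ s)) (w s)) (𝓝[>] a) (𝓝 0) := by
          simpa using (hya.comp hθa').dist hwa
        simpa [Function.comp_def] using (continuous_halfSinSq K N).continuousAt.tendsto.comp h)
      (fun t ht => by
        have htI := hsub (Ioo_subset_Ioc_self ht)
        refine (rightSlopeLE_halfSinSq_timeChange hN hf hy hyE hw (hbI (hb'b t htI))
          (hbI (hθI' t htI)) htI.2 (fun s hs => hθm htI ⟨htI.1.trans hs.1, hs.2⟩ hs.1)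
          (hdist _ (hθI' t htI) _ (hb'b t htI)) (hθd t htI)).mono ?_
        exact mul_le_mul_of_nonneg_right (hC t ht) (halfSinSq_nonneg _ _ _)) t₀ ⟨ht₀.1, le_rfl⟩
    exact dist_eq_zero.1 (eq_zero_of_halfSinSq_eq_zero hN dist_nonneg
      (hdist _ (hθI' t₀ ht₀) _ (hb'b t₀ ht₀)) (le_antisymm key (halfSinSq_nonneg _ _ _)))
  -- Once `y ∘ θ = w`, the right derivative of `θ` is `1`, so `θ - id` is constant, and its limit at
  -- `a` is `0`.
  have hθid : ∀ t ∈ Ioo a b', θ t = t := by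
    intro t ht
    have hconst : ∀ s ∈ Ioo a t, θ t - t = θ s - s := by
      intro s hs
      have hsub : Icc s t ⊆ Ioo a b' := fun r hr => ⟨hs.1.trans_le hr.1, hr.2.trans_lt ht.2⟩
      refine constant_of_has_deriv_right_zero (f := fun r => θ r - r)
        ((hθc.mono hsub).sub continuousOn_id) (fun r hr => ?_) t (right_mem_Icc.2 hs.2.le)
      have hrI := hsub (Ico_subset_Icc_self hr)
      have h := hθd r hrI
      rw [heq r hrI, div_self (Real.exp_ne_zero _)] at h
      have h2 := (hasDerivWithinAt_Ioi_iff_Ici.1 h).sub (hasDerivWithinAt_id r (Ici r))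
      rw [sub_self] at h2
      exact h2
    have hlim : Tendsto (fun s => θ s - s) (𝓝[>] a) (𝓝 (a - a)) :=
      hθa.sub (tendsto_id.mono_left nhdsWithin_le_nhds)
    have hlim' : Tendsto (fun s => θ s - s) (𝓝[>] a) (𝓝 (θ t - t)) := by
      refine tendsto_const_nhds.congr' ?_
      filter_upwards [Ioo_mem_nhdsGT ht.1] with s hs using hconst s hs
    have := tendsto_nhds_unique hlim hlim'
    linarith
  refine ⟨b', hb'.1, fun t ht => ?_⟩
  have h := heq t ht
  rwa [hθid t ht] at h

end MetricFlow

/-- Continuous induction: the coincidence set is closed in a compact interval, and local uniqueness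
restarted at a point of coincidence extends it to the right. -/
theorem mainTheorem5 {X : Type*} [MetricSpace X] (f : X → EReal) (hf : LowerSemicontinuous f)
    (K N : ℝ) (hN : N < 0) (T : EReal) (hT : 0 < T) (y₀ : X) (D : Set X)
    (hD : D ⊆ MetricFlow.finDomain f)
    (hflow : ∀ x ∈ D, ∃ τ : EReal, 0 < τ ∧ ∃ w : ℝ → X,
      MetricFlow.IsEVICurve K N f τ w ∧ MetricFlow.StartsAt w x)
    (y : ℝ → X) (hy : MetricFlow.IsMaximalSlopeCurve f T y) (hy₀ : MetricFlow.StartsAt y y₀)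
    (hyD : ∀ t ∈ MetricFlow.timeInterval T, y t ∈ D)
    (y' : ℝ → X) (hy' : MetricFlow.IsEVICurve K N f T y') (hy'₀ : MetricFlow.StartsAt y' y₀)
    (hKN : 0 ≤ K ∨
      (MetricFlow.IsKNConvex K N f ∧ ∃ M : ℝ, ∀ x : X, f x ≤ (M : EReal))) :
    ∀ t ∈ MetricFlow.timeInterval T, y t = y' t := by
  have hbdd : K < 0 → ∃ M : ℝ, ∀ x : X, f x ≤ (M : EReal) := fun hK =>
    hKN.elim (fun h => absurd hK (not_lt.2 h)) And.right
  have hlocal := fun {a : ℝ} {p : X} => MetricFlow.exists_eqOn_Ioo (a := a) (p := p) hN hf hy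
    (fun t ht => hflow _ (hyD t ht)) hy' hbdd
  obtain ⟨b, hb, hyb⟩ := hlocal (a := 0) le_rfl (by simpa using hT) hy₀ hy'₀
  intro t ht
  -- The induction starts at a positive time, inside the first interval of coincidence, because the
  -- curves are given only on `(0, T)`.
  set s := min (b / 2) t with hs
  have hs0 : 0 < s := lt_min (half_pos hb) ht.1
  have hsI : Icc s t ⊆ MetricFlow.timeInterval T := fun r hr =>
    MetricFlow.timeInterval_of_le ht (hs0.trans_le hr.1) hr.2
  have hyc := hy.locallyAC.continuousOn
  have hy'c := hy'.continuousOn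
  have hall : Icc s t ⊆ {r | y r = y' r} := by
    refine IsClosed.Icc_subset_of_forall_exists_gt ?_ ?_ ?_
    · rw [inter_comm]
      exact ((hyc.mono hsI).prodMk (hy'c.mono hsI)).preimage_isClosed_of_isClosed isClosed_Icc
        isClosed_diagonal
    · exact hyb ⟨hs0, (min_le_left _ _).trans_lt (half_lt_self hb)⟩
    · rintro r ⟨hr, hrI⟩ c hc
      have hrT := hsI (Ico_subset_Icc_self hrI)
      have hnhds := (MetricFlow.isOpen_timeInterval T).mem_nhds hrT
      obtain ⟨e, he, hye⟩ := hlocal (a := r) (p := y r) hrT.1.le hrT.2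
        ((hyc.continuousAt hnhds).tendsto.mono_left nhdsWithin_le_nhds)
        (by
          have h := (hy'c.continuousAt hnhds).tendsto.mono_left
            (nhdsWithin_le_nhds (s := Ioi r))
          rwa [← show y r = y' r from hr] at h)
      obtain ⟨q, hq⟩ := exists_between (lt_min he (mem_Ioi.1 hc))
      exact ⟨q, hye ⟨hq.1, hq.2.trans_le (min_le_left _ _)⟩, hq.1,
        (hq.2.trans_le (min_le_right _ _)).le⟩
  exact hall ⟨min_le_right _ _, le_rfl⟩
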